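/- **Setting.** Let $\Theta$ be a Borel type space with a probability measure $\lambda$ (the distribution of types). An agent of type $\theta$ lives for a random time with distribution function $F(\cdot\mid\theta)$ on $[0,\infty)$, depending measurably on $\theta$, with mean $1/\kappa$ for every $\theta$ ($\kappa>0$); in steady state the ages of agents of type $\theta$ have distribution function $G(z\mid\theta)=\kappa\int_0^z(1-F(\tau\mid\theta))\,d\tau$. Let $\rho>0$. When a machine is fixed, it works for a random lifespan drawn from a fixed distribution on $(0,\infty)$ with mean $1/\rho$; when it breaks, a random cumulative contribution (a quantum) drawn from a fixed distribution on $(0,\infty)$ with mean $1$ is needed to fix it. Both are drawn independently of the history. A *system process* is a jointly measurable process $X_t=(\omega_t,r_t,p_t)$, $t\in\mathbf R$, on some probability space, where $\omega_t\in\{W,B\}$ (working, broken) has right-continuous paths with left limits, and $r_t,p_t:\Theta\times\mathbf R_+\to[0,1]$ give the usage level $r_t(\theta,z)$ and the contribution level $p_t(\theta,z)$ of agents of type $\theta$ and age $z$. It is *stationary* if its law is invariant under time shifts. Write $\bar r_t(\theta)=\int r_t(\theta,z)\,G(dz\mid\theta)$ and $\bar p_t(\theta)=\int p_t(\theta,z)\,G(dz\mid\theta)$.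 The $i$-th lifespan ($i\ge1$) is the length of the working spell that starts with the $i$-th fix after time $0$, and the $i$-th quantum is the integral of $\int\bar p_t\,d\lambda$ over the broken spell that starts with the $i$-th breakdown after time $0$. A stationary system process is *admissible* if (1) the lifespans after time $0$ are i.i.d. with the lifespan distribution, and the residual lifespan at time $0$ is finite; (2) the quanta after time $0$ are i.i.d. with the quantum distribution, and the residual quantum at time $0$ is finite; (3) almost surely, $r_t(\theta,z)\le\mathbf 1_{[\omega_t=W]}$ and $p_t(\theta,z)\le\mathbf 1_{[\omega_t=B]}$ for all $t,\theta,z$. Since the machine may remain broken forever when agents do not contribute, "i.i.d." means that the process can be coupled with an i.i.d. sequence such that the $i$-th lifespan (quantum) equals the $i$-th term if the spell is completed, and does not exceed it if the spell never ends. The *reduced form* of $X$ is the triple $R(\theta)=\mathbf E\,\bar r_t(\theta)$, $P(\theta)=\mathbf E\,\bar p_t(\theta)$, $Q=\Pr(\omega_t=W)$. A *Markovian mechanism* is a Borel function $\sigma:\Theta\times\{W,B\}\to[0,1]$. It is *compatible* with $X$ ($X$ is induced by $\sigma$) if, almost surely, for all $t,\theta,z$: $r_t(\theta,z)=\sigma(\theta,W)$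 and $p_t(\theta,z)=0$ when $\omega_t=W$, and $r_t(\theta,z)=0$ and $p_t(\theta,z)=\sigma(\theta,B)$ when $\omega_t=B$; and the lifespans and quanta that start after time $0$ are drawn from their distributions, independently of each other and of the history (the process up to time $0$, with the residual lifespan and residual quantum at time $0$). A triple $(R,P,Q)$ of Borel functions $R,P:\Theta\to[0,1]$ and a number $Q\in[0,1]$ *satisfies the physical constraints* if $$\rho\,Q=\int P\,d\lambda\qquad\text{and}\qquad R(\theta)\le Q,\quad P(\theta)\le 1-Q\quad\text{for all }\theta\in\Theta .$$ **Proposition.** 1. The reduced form of every admissible stationary system process is well defined (it does not depend on $t$) and satisfies the physical constraints. 2. If a triple $(R,P,Q)$ satisfies the physical constraints, then there are a Markovian mechanism $\sigma$ and an admissible stationary system process $X$ such that $\sigma$ is compatible with $X$ and $(R,P,Q)$ is the reduced form of $X$. -/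

import Mathlib

open MeasureTheory ProbabilityTheory Set Filter
open scoped NNReal ENNReal Topology

namespace FluidClub

/-- The state of the machine. -/
inductive MachineState where
  | working
  | broken

instance : MeasurableSpace MachineState := ⊤

instance : DiscreteMeasurableSpace MachineState := ⟨fun _ => trivial⟩

/-- The primitives of the fluid model with type space `Θ`. -/
structure FluidModel (Θ : Type*) [MeasurableSpace Θ] where
  /-- The distribution of types. -/
  typeLaw : Measure Θ
  typeLaw_prob : IsProbabilityMeasure typeLaw
  /-- The distribution of the life of an agent, given his type. -/
  agentLife : Kernel Θ ℝ≥0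
  agentLife_markov : IsMarkovKernel agentLife
  /-- The birth (and death) rate of agents. -/
  κ : ℝ
  κ_pos : 0 < κ
  agentLife_mean : ∀ θ, ∫⁻ τ, (τ : ℝ≥0∞) ∂(agentLife θ) = ENNReal.ofReal (1 / κ)
  /-- The breakage rate of the machine. -/
  ρ : ℝ
  ρ_pos : 0 < ρ
  /-- The distribution of the lifespan of a machine that has just been fixed. -/
  lifespanLaw : Measure ℝ≥0
  lifespanLaw_prob : IsProbabilityMeasure lifespanLaw
  lifespanLaw_pos : ∀ᵐ l ∂lifespanLaw, 0 < l
  lifespanLaw_mean : ∫⁻ l, (l : ℝ≥0∞) ∂lifespanLaw = ENNReal.ofReal (1 / ρ)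
  /-- The distribution of the contribution quantum needed to fix a machine that has just broken. -/
  quantumLaw : Measure ℝ≥0
  quantumLaw_prob : IsProbabilityMeasure quantumLaw
  quantumLaw_pos : ∀ᵐ m ∂quantumLaw, 0 < m
  quantumLaw_mean : ∫⁻ m, (m : ℝ≥0∞) ∂quantumLaw = 1

/-- The steady-state distribution of ages of the agents of type `θ`; its distribution function is
`G(z ∣ θ) = κ ∫₀ᶻ (1 - F(τ ∣ θ)) dτ`, where `F(· ∣ θ)` is the distribution function of lives. -/
noncomputable def FluidModel.ageLaw {Θ : Type*} [MeasurableSpace Θ] (M : FluidModel Θ) (θ : Θ) :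
    Measure ℝ≥0 :=
  ((volume : Measure ℝ).comap ((↑) : ℝ≥0 → ℝ)).withDensity
    (fun z => ENNReal.ofReal M.κ * M.agentLife θ (Ioi z))

/-- A triple (usage levels `R`, contribution levels `P`, uptime `Q`). -/
@[ext]
structure Triple (Θ : Type*) where
  R : Θ → ℝ
  P : Θ → ℝ
  Q : ℝ

/-- The physical constraints on a triple `R, P : Θ → [0, 1]` (Borel), `Q ∈ [0, 1]`: the balance
condition and the simplex bounds. -/
structure Triple.IsPhysical {Θ : Type*} [MeasurableSpace Θ] (T : Triple Θ) (M : FluidModel Θ) :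
    Prop where
  measurable_R : Measurable T.R
  measurable_P : Measurable T.P
  R_mem : ∀ θ, T.R θ ∈ Icc (0 : ℝ) 1
  P_mem : ∀ θ, T.P θ ∈ Icc (0 : ℝ) 1
  Q_mem : T.Q ∈ Icc (0 : ℝ) 1
  balance : M.ρ * T.Q = ∫ θ, T.P θ ∂M.typeLaw
  simplex_R : ∀ θ, T.R θ ≤ T.Q
  simplex_P : ∀ θ, T.P θ ≤ 1 - T.Q

/-! ### Paths of the machine state -/

/-- Paths that are right-continuous with left limits, so that the machine changes its state only
finitely often in a bounded period. -/
def IsRegularPath (w : ℝ → MachineState) : Prop :=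
  ∀ t, (∀ᶠ s in 𝓝[>] t, w s = w t) ∧ ∃ v, ∀ᶠ s in 𝓝[<] t, w s = v

/-- The machine is fixed at time `s`. -/
def IsFixTime (w : ℝ → MachineState) (s : ℝ) : Prop :=
  w s = .working ∧ ∀ᶠ u in 𝓝[<] s, w u = .broken

/-- The machine breaks at time `s`. -/
def IsBreakTime (w : ℝ → MachineState) (s : ℝ) : Prop :=
  w s = .broken ∧ ∀ᶠ u in 𝓝[<] s, w u = .working

/-- The number of times that the machine is fixed in `(0, t]`. -/
noncomputable def fixCount (w : ℝ → MachineState) (t : ℝ) : ℕ∞ :=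
  {s | s ∈ Ioc 0 t ∧ IsFixTime w s}.encard

/-- The number of times that the machine breaks in `(0, t]`. -/
noncomputable def breakCount (w : ℝ → MachineState) (t : ℝ) : ℕ∞ :=
  {s | s ∈ Ioc 0 t ∧ IsBreakTime w s}.encard

/-- The times at which the machine works after having been fixed exactly `i` times after time `0`:
for `i ≥ 1` the working spell that starts with the `i`-th fix after time `0`, and for `i = 0` the
part after time `0` of the working spell in progress at time `0` (if any). -/
def workingSpell (w : ℝ → MachineState) (i : ℕ) : Set ℝ :=
  {t | 0 < t ∧ w t = .working ∧ fixCount w t = i}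

/-- The times at which the machine is broken after having broken exactly `i` times after time `0`:
for `i ≥ 1` the broken spell that starts with the `i`-th breakdown after time `0`, and for `i = 0`
the part after time `0` of the broken spell in progress at time `0` (if any). -/
def brokenSpell (w : ℝ → MachineState) (i : ℕ) : Set ℝ :=
  {t | 0 < t ∧ w t = .broken ∧ breakCount w t = i}

/-- The `i`-th working spell after time `0` has started and ended. -/
def LifespanCompleted (w : ℝ → MachineState) (i : ℕ) : Prop :=
  ∃ t > 0, w t = .broken ∧ fixCount w t = i

/-- The `i`-th broken spell after time `0` has started and ended. -/
def QuantumCompleted (w : ℝ → MachineState) (i : ℕ) : Prop :=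
  ∃ t > 0, w t = .working ∧ breakCount w t = i

/-- The duration of the `i`-th working spell after time `0` (for `i = 0`: the residual lifespan
at time `0`). -/
noncomputable def lifespan (w : ℝ → MachineState) (i : ℕ) : ℝ≥0∞ :=
  volume (workingSpell w i)

/-! ### System processes -/

/-- The space of values of a system process: machine state, usage levels and contribution levels
of each type and age. Function spaces carry the product σ-algebra. -/
abbrev SystemState (Θ : Type*) : Type _ :=
  MachineState × (Θ → ℝ≥0 → unitInterval) × (Θ → ℝ≥0 → unitInterval)

/-- A system process `X_t = (ω_t, r_t, p_t)`, `t ∈ ℝ`, on the sample space `S`. -/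
structure SystemProcess (Θ : Type*) [MeasurableSpace Θ] (S : Type*) [MeasurableSpace S] where
  prob : Measure S
  isProb : IsProbabilityMeasure prob
  state : ℝ → S → MachineState
  usage : ℝ → S → Θ → ℝ≥0 → unitInterval
  contribution : ℝ → S → Θ → ℝ≥0 → unitInterval
  measurable_state : Measurable (fun q : ℝ × S => state q.1 q.2)
  measurable_usage :
    Measurable (fun q : ℝ × S × Θ × ℝ≥0 => usage q.1 q.2.1 q.2.2.1 q.2.2.2)
  measurable_contribution :
    Measurable (fun q : ℝ × S × Θ × ℝ≥0 => contribution q.1 q.2.1 q.2.2.1 q.2.2.2)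
  regular : ∀ᵐ x ∂prob, IsRegularPath (fun t => state t x)

namespace SystemProcess

variable {Θ : Type*} [MeasurableSpace Θ] {S : Type*} [MeasurableSpace S]

/-- The value of the system process at time `t`. -/
def value (X : SystemProcess Θ S) (t : ℝ) (x : S) : SystemState Θ :=
  (X.state t x, X.usage t x, X.contribution t x)

/-- The path of the machine state. -/
def path (X : SystemProcess Θ S) (x : S) : ℝ → MachineState := fun t => X.state t x

/-- Stationarity: the law of the process is invariant under time shifts. -/
def IsStationary (X : SystemProcess Θ S) : Prop :=
  ∀ h : ℝ, IdentDistrib (fun x (t : ℝ) => X.value (t + h) x) (fun x (t : ℝ) => X.value t x)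
    X.prob X.prob

/-- The average usage level of the agents of type `θ` at time `t`. -/
noncomputable def avgUsage (X : SystemProcess Θ S) (M : FluidModel Θ) (t : ℝ) (x : S) (θ : Θ) : ℝ :=
  ∫ z, (X.usage t x θ z : ℝ) ∂(M.ageLaw θ)

/-- The average contribution level of the agents of type `θ` at time `t`. -/
noncomputable def avgContribution (X : SystemProcess Θ S) (M : FluidModel Θ) (t : ℝ) (x : S)
    (θ : Θ) : ℝ :=
  ∫ z, (X.contribution t x θ z : ℝ) ∂(M.ageLaw θ)

/-- The contribution rate at time `t`, aggregated across agents. -/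
noncomputable def contributionRate (X : SystemProcess Θ S) (M : FluidModel Θ) (t : ℝ) (x : S) : ℝ :=
  ∫ θ, X.avgContribution M t x θ ∂M.typeLaw

/-- The cumulative contribution during the `i`-th broken spell after time `0` (for `i = 0`: during
the rest of the broken spell in progress at time `0`). -/
noncomputable def quantum (X : SystemProcess Θ S) (M : FluidModel Θ) (i : ℕ) (x : S) : ℝ≥0∞ :=
  ∫⁻ t in brokenSpell (X.path x) i, ENNReal.ofReal (X.contributionRate M t x)

/-- Given drawn lifespans `l 0, l 1, …`, the `i`-th lifespan after time `0` is the `i`-th draw.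
If the spell has not started or never ends, its duration merely does not exceed the draw. -/
def LifespansAgree (X : SystemProcess Θ S) (x : S) (l : ℕ → ℝ≥0) : Prop :=
  ∀ i : ℕ, lifespan (X.path x) (i + 1) ≤ l i ∧
    (LifespanCompleted (X.path x) (i + 1) → lifespan (X.path x) (i + 1) = l i)

/-- Given drawn quanta `m 0, m 1, …`, the cumulative contribution during the `i`-th broken spell
after time `0` is the `i`-th draw. If the spell has not started or never ends, the cumulative
contribution merely does not exceed the draw. -/
def QuantaAgree (X : SystemProcess Θ S) (M : FluidModel Θ) (x : S) (m : ℕ → ℝ≥0) : Prop :=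
  ∀ i : ℕ, X.quantum M (i + 1) x ≤ m i ∧
    (QuantumCompleted (X.path x) (i + 1) → X.quantum M (i + 1) x = m i)

/-- Admissible stationary system processes. The sequences of lifespans and of quanta after time `0`
are i.i.d. with the given distributions, and the residual ones at time `0` are finite. As a machine
may remain broken forever if agents do not contribute, i.i.d. means that there is a coupling of the
process with an i.i.d. sequence that agrees with the spells that take place. If almost surely
infinitely many spells take place, this is the statement that the sequence itself is i.i.d. -/
structure IsAdmissible (X : SystemProcess Θ S) (M : FluidModel Θ) : Prop where
  stationary : X.IsStationary
  lifespan_residual : ∀ᵐ x ∂X.prob, lifespan (X.path x) 0 < ∞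
  lifespan_iid : ∃ γ : Measure (S × (ℕ → ℝ≥0)),
    γ.map Prod.fst = X.prob ∧
    γ.map Prod.snd = Measure.infinitePi (fun _ : ℕ => M.lifespanLaw) ∧
    ∀ᵐ q ∂γ, X.LifespansAgree q.1 q.2
  quantum_residual : ∀ᵐ x ∂X.prob, X.quantum M 0 x < ∞
  quantum_iid : ∃ γ : Measure (S × (ℕ → ℝ≥0)),
    γ.map Prod.fst = X.prob ∧
    γ.map Prod.snd = Measure.infinitePi (fun _ : ℕ => M.quantumLaw) ∧
    ∀ᵐ q ∂γ, X.QuantaAgree M q.1 q.2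
  usage_le : ∀ᵐ x ∂X.prob, ∀ t θ z,
    (X.usage t x θ z : ℝ) ≤ {s | X.state s x = .working}.indicator 1 t
  contribution_le : ∀ᵐ x ∂X.prob, ∀ t θ z,
    (X.contribution t x θ z : ℝ) ≤ {s | X.state s x = .broken}.indicator 1 t

/-- The reduced form at time `t`: expected average usage and contribution levels of each type, and
the probability that the machine is working. -/
noncomputable def reducedFormAt (X : SystemProcess Θ S) (M : FluidModel Θ) (t : ℝ) : Triple Θ where
  R := fun θ => ∫ x, X.avgUsage M t x θ ∂X.prob
  P := fun θ => ∫ x, X.avgContribution M t x θ ∂X.prob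
  Q := X.prob.real {x | X.state t x = .working}

/-- `T` is the reduced form of the process (at each time). -/
def HasReducedForm (X : SystemProcess Θ S) (M : FluidModel Θ) (T : Triple Θ) : Prop :=
  ∀ t, X.reducedFormAt M t = T

/-- The history of the process up to time `0`, with the residual lifespan and the residual quantum
of the spell in progress at time `0`. -/
noncomputable def history (X : SystemProcess Θ S) (M : FluidModel Θ) (x : S) :
    (Iic (0 : ℝ) → SystemState Θ) × ℝ≥0∞ × ℝ≥0∞ :=
  (fun t => X.value t x, lifespan (X.path x) 0, X.quantum M 0 x)

end SystemProcess

/-- A Markovian mechanism: a Borel function `σ : Θ × {W, B} → [0, 1]`. -/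
structure MarkovianMechanism (Θ : Type*) [MeasurableSpace Θ] where
  level : Θ × MachineState → unitInterval
  measurable_level : Measurable level

/-- The Markovian mechanism `σ` is compatible with the process `X` (`X` is a process induced by
`σ`): agents of type `θ` use the working machine at level `σ(θ, W)`, do not use the broken machine,
contribute to the broken machine at level `σ(θ, B)`, do not contribute to the working machine, and
the lifespans and quanta that start after time `0` are drawn from their distributions independently
of each other and of the history. -/
structure MarkovianMechanism.IsCompatible {Θ : Type*} [MeasurableSpace Θ] {S : Type*}
    [MeasurableSpace S] (σ : MarkovianMechanism Θ) (M : FluidModel Θ) (X : SystemProcess Θ S) :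
    Prop where
  levels_working : ∀ᵐ x ∂X.prob, ∀ t, X.state t x = .working → ∀ θ z,
    X.usage t x θ z = σ.level (θ, .working) ∧ X.contribution t x θ z = 0
  levels_broken : ∀ᵐ x ∂X.prob, ∀ t, X.state t x = .broken → ∀ θ z,
    X.usage t x θ z = 0 ∧ X.contribution t x θ z = σ.level (θ, .broken)
  machine : ∃ γ : Measure (S × (ℕ → ℝ≥0) × (ℕ → ℝ≥0)),
    γ.map Prod.fst = X.prob ∧
    γ.map Prod.snd = (Measure.infinitePi (fun _ : ℕ => M.lifespanLaw)).prod
      (Measure.infinitePi (fun _ : ℕ => M.quantumLaw)) ∧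
    IndepFun (fun q => X.history M q.1) Prod.snd γ ∧
    ∀ᵐ q ∂γ, X.LifespansAgree q.1 q.2.1 ∧ X.QuantaAgree M q.1 q.2.2

end FluidClub

namespace FluidClub

/-! Necessity. The simplex bounds are expectations of the pointwise bounds on levels, so the content
is the balance condition. Let `W T` be the working time and `C T` the cumulative contribution in
`(0, T]`. Along a path, fixes and breakdowns alternate, so their numbers `N T` and `B T` differ by
at most one. Up to the finite residual at time `0` and the last spell, `W T` is a sum of `N T` drawn
lifespans and `C T` a sum of `B T` drawn quanta. By the strong law, both `ρ * W T` and `C T` are `N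
T` up to a small multiple of `N T` plus a constant, and `N T` grows at most linearly in `T`. Hence
`(ρ * W T - C T) / T → 0` almost surely, even if the machine stops changing its state
(`tendsto_balance`, `tendsto_balance_path`). By stationarity the expectation of this quotient is `ρ
Q - ∫ P` for every `T ≥ 1`, and dominated convergence makes it `0` (`IsAdmissible.balance`).

Sufficiency. The mechanism must prescribe the levels conditional on the state, `R / Q` and `P / (1 -
Q)`. By balance its contribution rate to the broken machine is `c = ρ Q / (1 - Q)`; the case `Q = 1`
is impossible because then `P = 0` and `ρ Q = 0`. If `Q = 0`, the machine that is always broken will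
do. If `Q > 0`, the process is the stationary alternating renewal process: a two-sided sequence of
independent cycles, weighted by the length of the cycle `0`, seen from a uniformly distributed time
in that cycle. Its uptime is the ratio of means `(1 / ρ) / (1 / ρ + 1 / c) = Q`.

Stationarity follows from `lintegral_cycle_eq`: the integral over a window of one cycle length does
not depend, in expectation, on where the window starts. Independence of fresh draws and history
(`stationaryLaw_inter_draws`) survives the length weighting because, for each fixed elapsed time in
the cycle `0`, the event that this cycle is still in progress is determined by the past. -/

theorem integrable_coe_of_mean {μ : Measure ℝ≥0} {c : ℝ}
    (hμ : ∫⁻ l, (l : ℝ≥0∞) ∂μ = ENNReal.ofReal c) : Integrable (fun l : ℝ≥0 => (l : ℝ)) μ := by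
  refine ⟨by fun_prop, ?_⟩
  rw [HasFiniteIntegral]
  simp [hμ]

theorem integral_coe_of_mean {μ : Measure ℝ≥0} {c : ℝ} (hc : 0 ≤ c)
    (hμ : ∫⁻ l, (l : ℝ≥0∞) ∂μ = ENNReal.ofReal c) : ∫ l, (l : ℝ) ∂μ = c := by
  rw [integral_eq_lintegral_of_nonneg_ae (Eventually.of_forall fun l => l.2) (by fun_prop)]
  simp [hμ, hc]

/-- The strong law of large numbers for a nonnegative i.i.d. sequence, as a statement about the
product measure. -/
theorem ae_tendsto_average_infinitePi (μ : Measure ℝ≥0) [IsProbabilityMeasure μ] {c : ℝ}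
    (hc : 0 ≤ c) (hμ : ∫⁻ l, (l : ℝ≥0∞) ∂μ = ENNReal.ofReal c) :
    ∀ᵐ x ∂Measure.infinitePi (fun _ : ℕ => μ),
      Tendsto (fun n : ℕ => (∑ i ∈ Finset.range n, (x i : ℝ)) / n) atTop (𝓝 c) := by
  have hmp : ∀ i : ℕ, MeasurePreserving (fun x : ℕ → ℝ≥0 => x i)
      (Measure.infinitePi (fun _ : ℕ => μ)) μ :=
    fun i => measurePreserving_eval_infinitePi (fun _ : ℕ => μ) i
  have hid : ∀ i : ℕ, IdentDistrib (fun x : ℕ → ℝ≥0 => (x i : ℝ)) (fun x => (x 0 : ℝ))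
      (Measure.infinitePi (fun _ : ℕ => μ)) (Measure.infinitePi (fun _ : ℕ => μ)) := fun i =>
    IdentDistrib.comp (u := fun l : ℝ≥0 => (l : ℝ))
      ⟨(hmp i).aemeasurable, (hmp 0).aemeasurable, by rw [(hmp i).map_eq, (hmp 0).map_eq]⟩
      (by fun_prop)
  have hind : iIndepFun (fun (i : ℕ) (x : ℕ → ℝ≥0) => (x i : ℝ))
      (Measure.infinitePi (fun _ : ℕ => μ)) :=
    iIndepFun_infinitePi (X := fun _ (l : ℝ≥0) => (l : ℝ)) (fun _ => by fun_prop)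
  have h := strong_law_ae_real (fun (i : ℕ) (x : ℕ → ℝ≥0) => (x i : ℝ))
    ((hmp 0).integrable_comp_of_integrable (integrable_coe_of_mean hμ))
    (fun i j hij => hind.indepFun hij) hid
  have hE : ∫ x : ℕ → ℝ≥0, (x 0 : ℝ) ∂Measure.infinitePi (fun _ : ℕ => μ) = c := by
    have h' := integral_map (f := fun l : ℝ≥0 => (l : ℝ)) (hmp 0).aemeasurable (by fun_prop)
    rw [(hmp 0).map_eq, integral_coe_of_mean hc hμ] at h'
    exact h'.symm
  rwa [hE] at h

/-- Families of coordinates over a set of indices and over its complement are independent under a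
product measure. -/
theorem indepFun_domRestrict_compl_infinitePi {ι : Type*} {E : ι → Type*}
    [∀ i, MeasurableSpace (E i)] (μ : ∀ i, Measure (E i)) [∀ i, IsProbabilityMeasure (μ i)]
    (J : Set ι) : IndepFun J.domRestrict Jᶜ.domRestrict (Measure.infinitePi μ) := by
  have h := iIndepFun_infinitePi (P := μ) (X := fun _ x => x) (fun _ => measurable_id)
  have h' := indep_iSup_of_disjoint (fun i => Measurable.comap_le (measurable_pi_apply i))
    h.iIndep (disjoint_compl_right (a := J))
  have key : ∀ K : Set ι, MeasurableSpace.comap (K.domRestrict (π := E)) inferInstance ≤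
      ⨆ i ∈ K, MeasurableSpace.comap (fun x : ∀ i, E i => x i) inferInstance := by
    intro K
    rw [MeasurableSpace.pi, MeasurableSpace.comap_iSup]
    refine iSup_le fun i => ?_
    rw [MeasurableSpace.comap_comp]
    exact le_iSup₂_of_le (i : ι) i.2 le_rfl
  rw [IndepFun_iff_Indep]
  exact indep_of_indep_of_le_left (indep_of_indep_of_le_right h' (key _)) (key _)

/-! ### The steady-state age distributions -/

section AgeLaw

variable {Θ : Type*} [MeasurableSpace Θ] (M : FluidModel Θ)

theorem measurableEmbedding_nnreal_coe : MeasurableEmbedding ((↑) : ℝ≥0 → ℝ) :=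
  NNReal.isClosedEmbedding_coe.measurableEmbedding

instance : SigmaFinite ((volume : Measure ℝ).comap ((↑) : ℝ≥0 → ℝ)) := by
  have := IsFiniteMeasureOnCompacts.comap' (volume : Measure ℝ)
    NNReal.continuous_coe measurableEmbedding_nnreal_coe
  infer_instance

theorem measurable_agentLife_Ioi :
    Measurable (Function.uncurry fun (θ : Θ) (z : ℝ≥0) =>
      ENNReal.ofReal M.κ * M.agentLife θ (Ioi z)) := by
  have := M.agentLife_markov
  refine Measurable.const_mul ?_ _
  have hs : MeasurableSet {p : (Θ × ℝ≥0) × ℝ≥0 | p.1.2 < p.2} :=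
    measurableSet_lt (by fun_prop) (by fun_prop)
  exact Kernel.measurable_kernel_prodMk_left (κ := M.agentLife.comap Prod.fst measurable_fst) hs

/-- The age distributions as a kernel. -/
noncomputable def FluidModel.ageKernel : Kernel Θ ℝ≥0 :=
  (Kernel.const Θ ((volume : Measure ℝ).comap ((↑) : ℝ≥0 → ℝ))).withDensity
    (fun θ z => ENNReal.ofReal M.κ * M.agentLife θ (Ioi z))

theorem FluidModel.ageKernel_apply (θ : Θ) : M.ageKernel θ = M.ageLaw θ := by
  rw [FluidModel.ageKernel, Kernel.withDensity_apply _ (measurable_agentLife_Ioi M)]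
  rfl

/-- By Tonelli on the set `z < τ`, the integral of the survival probabilities is the mean life `1 /
κ`, which the factor `κ` normalises. -/
theorem FluidModel.isProbabilityMeasure_ageLaw (θ : Θ) : IsProbabilityMeasure (M.ageLaw θ) := by
  have := M.agentLife_markov
  constructor
  rw [FluidModel.ageLaw, withDensity_apply _ MeasurableSet.univ, Measure.restrict_univ]
  have hs : MeasurableSet {p : ℝ≥0 × ℝ≥0 | p.1 < p.2} :=
    measurableSet_lt (by fun_prop) (by fun_prop)
  have hm : Measurable fun z : ℝ≥0 => M.agentLife θ (Ioi z) :=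
    measurable_measure_prodMk_left hs
  rw [lintegral_const_mul _ hm]
  have h1 := Measure.prod_apply (μ := (volume : Measure ℝ).comap ((↑) : ℝ≥0 → ℝ))
    (ν := M.agentLife θ) hs
  have h2 := Measure.prod_apply_symm (μ := (volume : Measure ℝ).comap ((↑) : ℝ≥0 → ℝ))
    (ν := M.agentLife θ) hs
  have h3 : ∀ τ : ℝ≥0, (volume : Measure ℝ).comap ((↑) : ℝ≥0 → ℝ)
      ((fun z => (z, τ)) ⁻¹' {p : ℝ≥0 × ℝ≥0 | p.1 < p.2}) = τ := by
    intro τ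
    rw [measurableEmbedding_nnreal_coe.comap_apply]
    have : ((↑) : ℝ≥0 → ℝ) '' ((fun z => (z, τ)) ⁻¹' {p : ℝ≥0 × ℝ≥0 | p.1 < p.2}) = Ico 0 (τ : ℝ) := by
      ext x
      constructor
      · rintro ⟨z, hz, rfl⟩
        exact ⟨z.2, by exact_mod_cast hz⟩
      · rintro ⟨h0, h1⟩
        exact ⟨⟨x, h0⟩, by exact_mod_cast h1, rfl⟩
    rw [this]
    simp
  simp only [h3] at h2
  have h4 : ∫⁻ z, M.agentLife θ (Ioi z) ∂((volume : Measure ℝ).comap ((↑) : ℝ≥0 → ℝ)) =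
      ENNReal.ofReal (1 / M.κ) := by
    rw [← M.agentLife_mean θ, ← h2, h1]
    rfl
  rw [h4, ← ENNReal.ofReal_mul M.κ_pos.le, mul_one_div_cancel M.κ_pos.ne', ENNReal.ofReal_one]

instance FluidModel.isMarkovKernel_ageKernel : IsMarkovKernel M.ageKernel :=
  ⟨fun θ => by rw [M.ageKernel_apply]; exact M.isProbabilityMeasure_ageLaw θ⟩

end AgeLaw

/-! ### Exchanging the two states -/

/-- The other state of the machine. -/
def MachineState.flip : MachineState → MachineState
  | .working => .broken
  | .broken => .working

@[simp] theorem MachineState.flip_eq_working {v : MachineState} :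
    v.flip = .working ↔ v = .broken := by
  cases v <;> simp [MachineState.flip]

@[simp] theorem MachineState.flip_eq_broken {v : MachineState} :
    v.flip = .broken ↔ v = .working := by
  cases v <;> simp [MachineState.flip]

theorem MachineState.ne_working {v : MachineState} : v ≠ .working ↔ v = .broken := by
  cases v <;> simp

/-- The path with the two states exchanged. -/
def flipPath (w : ℝ → MachineState) : ℝ → MachineState := fun t => (w t).flip

variable {w : ℝ → MachineState}

@[simp] theorem flipPath_eq_working {t : ℝ} : flipPath w t = .working ↔ w t = .broken :=
  MachineState.flip_eq_working

@[simp] theorem flipPath_eq_broken {t : ℝ} : flipPath w t = .broken ↔ w t = .working :=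
  MachineState.flip_eq_broken

/-- Through this symmetry, every result on fixes and working spells is also one on breakdowns and
broken spells, and only the former are proved. -/
theorem isFixTime_flipPath {s : ℝ} : IsFixTime (flipPath w) s ↔ IsBreakTime w s := by
  simp [IsFixTime, IsBreakTime]

theorem fixCount_flipPath {t : ℝ} : fixCount (flipPath w) t = breakCount w t := by
  simp [fixCount, breakCount, isFixTime_flipPath]

theorem workingSpell_flipPath {i : ℕ} : workingSpell (flipPath w) i = brokenSpell w i := by
  simp [workingSpell, brokenSpell, fixCount_flipPath]

theorem lifespanCompleted_flipPath {i : ℕ} :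
    LifespanCompleted (flipPath w) i ↔ QuantumCompleted w i := by
  simp [LifespanCompleted, QuantumCompleted, fixCount_flipPath]

theorem IsRegularPath.flip (hw : IsRegularPath w) : IsRegularPath (flipPath w) := by
  intro t
  obtain ⟨h1, v, h2⟩ := hw t
  refine ⟨h1.mono fun s hs => ?_, v.flip, h2.mono fun s hs => ?_⟩ <;>
  simp only [flipPath, hs]

/-! ### Regular paths -/

/-- Induction along a regular path: a property that holds at time `0` and is propagated across
intervals on which the path is constant (before their right end) holds at all later times. -/
theorem IsRegularPath.induction (hw : IsRegularPath w) {p : ℝ → Prop} (h0 : p 0)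
    (step : ∀ s t, 0 ≤ s → s < t → (∀ u ∈ Ico s t, w u = w s) → p s → p t) :
    ∀ t, 0 ≤ t → p t := by
  by_contra! hcon
  obtain ⟨T, hT0, hT⟩ := hcon
  set A : Set ℝ := {t | 0 ≤ t ∧ ¬ p t} with hA
  have hbdd : BddBelow A := ⟨0, fun t ht => ht.1⟩
  have hne : A.Nonempty := ⟨T, hT0, hT⟩
  set c := sInf A with hc
  have hc0 : 0 ≤ c := le_csInf hne fun t ht => ht.1
  have hlt : ∀ s, 0 ≤ s → s < c → p s := by
    intro s hs hsc
    by_contra hps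
    exact absurd (csInf_le hbdd (show s ∈ A from ⟨hs, hps⟩)) (not_le.2 hsc)
  -- `c` is the infimum of the bad times. By the left limit the path is constant on some `[s, c)`
  -- with `0 ≤ s`, so `step` carries `p` to `c` itself.
  have hpc : p c := by
    rcases hc0.eq_or_lt with h | h
    · rwa [← h]
    · obtain ⟨-, v, hv⟩ := hw c
      obtain ⟨l, hl, hlc⟩ := (mem_nhdsLT_iff_exists_Ioo_subset' h).1 hv
      have hl' : l < c := hl
      have hm : max l 0 < c := max_lt hl' h
      have h1 : l < (max l 0 + c) / 2 := by linarith [le_max_left l 0]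
      have h2 : 0 ≤ (max l 0 + c) / 2 := by linarith [le_max_right l 0]
      have h3 : (max l 0 + c) / 2 < c := by linarith
      refine step _ c h2 h3 (fun u hu => ?_) (hlt _ h2 h3)
      have e1 : w u = v := hlc ⟨h1.trans_le hu.1, hu.2⟩
      have e2 : w ((max l 0 + c) / 2) = v := hlc ⟨h1, h3⟩
      rw [e1, e2]
  -- By right-continuity the path is constant on some `[c, r)`, so `step` carries `p` from `c` to a
  -- bad time `a < r`, a contradiction.
  obtain ⟨hr, -⟩ := hw c
  obtain ⟨r, hr, hcr⟩ := (mem_nhdsGT_iff_exists_Ioo_subset' (lt_add_one c)).1 hr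
  obtain ⟨a, ha, har⟩ := exists_lt_of_csInf_lt hne (show sInf A < r from hr)
  have hca : c ≤ a := csInf_le hbdd ha
  rcases hca.eq_or_lt with h | h
  · exact ha.2 (h ▸ hpc)
  · refine ha.2 (step c a hc0 h (fun u hu => ?_) hpc)
    rcases hu.1.eq_or_lt with h' | h'
    · rw [h']
    · exact hcr ⟨h', hu.2.trans har⟩

theorem fixCount_mono (w : ℝ → MachineState) : Monotone (fixCount w) := fun _ _ hst =>
  encard_le_encard fun _ hu => ⟨⟨hu.1.1, hu.1.2.trans hst⟩, hu.2⟩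

theorem fixCount_zero (w : ℝ → MachineState) : fixCount w 0 = 0 := by
  simp [fixCount]

theorem not_isFixTime_of_const {s t u : ℝ} (hc : ∀ u ∈ Ico s t, w u = w s) (hu : u ∈ Ioo s t) :
    ¬ IsFixTime w u := by
  rintro ⟨h1, h2⟩
  have h3 : ∀ᶠ v in 𝓝[<] u, v ∈ Ioo s u := Ioo_mem_nhdsLT hu.1
  obtain ⟨v, hv1, hv2⟩ := (h2.and h3).exists
  rw [hc v ⟨hv2.1.le, hv2.2.trans hu.2⟩] at hv1
  rw [hc u ⟨hu.1.le, hu.2⟩, hv1] at h1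
  cases h1

theorem isFixTime_iff_of_const {s t : ℝ} (hst : s < t) (hc : ∀ u ∈ Ico s t, w u = w s) :
    IsFixTime w t ↔ w t = .working ∧ w s = .broken := by
  have h3 : ∀ᶠ v in 𝓝[<] t, v ∈ Ioo s t := Ioo_mem_nhdsLT hst
  constructor
  · rintro ⟨h1, h2⟩
    obtain ⟨v, hv1, hv2⟩ := (h2.and h3).exists
    exact ⟨h1, by rw [← hc v ⟨hv2.1.le, hv2.2⟩, hv1]⟩
  · rintro ⟨h1, h2⟩
    exact ⟨h1, h3.mono fun v hv => by rw [hc v ⟨hv.1.le, hv.2⟩, h2]⟩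

theorem fixCount_of_const_of_isFixTime {s t : ℝ} (hs : 0 ≤ s) (hst : s < t)
    (hc : ∀ u ∈ Ico s t, w u = w s) (ht : IsFixTime w t) : fixCount w t = fixCount w s + 1 := by
  have : {u | u ∈ Ioc 0 t ∧ IsFixTime w u} = insert t {u | u ∈ Ioc 0 s ∧ IsFixTime w u} := by
    ext u
    constructor
    · rintro ⟨⟨h1, h2⟩, h3⟩
      rcases h2.eq_or_lt with h | h
      · exact Or.inl h
      · refine Or.inr ⟨⟨h1, ?_⟩, h3⟩
        by_contra hus
        exact not_isFixTime_of_const hc ⟨not_le.1 hus, h⟩ h3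
    · rintro (rfl | ⟨⟨h1, h2⟩, h3⟩)
      · exact ⟨⟨hs.trans_lt hst, le_rfl⟩, ht⟩
      · exact ⟨⟨h1, h2.trans hst.le⟩, h3⟩
  rw [fixCount, this, encard_insert_of_notMem, fixCount]
  rintro ⟨⟨-, h⟩, -⟩
  exact absurd h (not_le.2 hst)

theorem fixCount_of_const_of_not_isFixTime {s t : ℝ} (hst : s < t)
    (hc : ∀ u ∈ Ico s t, w u = w s) (ht : ¬ IsFixTime w t) : fixCount w t = fixCount w s := by
  refine le_antisymm (encard_le_encard ?_) (fixCount_mono w hst.le)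
  rintro u ⟨⟨h1, h2⟩, h3⟩
  refine ⟨⟨h1, ?_⟩, h3⟩
  by_contra hus
  rcases h2.eq_or_lt with h | h
  · exact ht (h ▸ h3)
  · exact not_isFixTime_of_const hc ⟨not_le.1 hus, h⟩ h3

/-- The numbers of fixes and of breakdowns up to a given time are finite and differ by at most
one. -/
theorem IsRegularPath.exists_counts (hw : IsRegularPath w) {t : ℝ} (ht : 0 ≤ t) :
    ∃ n b : ℕ, fixCount w t = n ∧ breakCount w t = b ∧ n ≤ b + 1 ∧ b ≤ n + 1 := by
  classical
  -- The exact relation between the counts and the two end states is what propagates along the path;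
  -- the inequalities alone would not.
  suffices h : ∃ n b : ℕ, fixCount w t = n ∧ breakCount w t = b ∧
      n + (if w 0 = .working then 1 else 0) = b + (if w t = .working then 1 else 0) by
    obtain ⟨n, b, h1, h2, h3⟩ := h
    refine ⟨n, b, h1, h2, ?_, ?_⟩ <;> split_ifs at h3 <;> omega
  refine hw.induction (p := fun t => ∃ n b : ℕ, fixCount w t = n ∧
      breakCount w t = b ∧
      n + (if w 0 = .working then 1 else 0) = b + (if w t = .working then 1 else 0)) ?_ ?_ t ht
  · refine ⟨0, 0, ?_, ?_, rfl⟩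
    · simp [fixCount_zero]
    · simp [← fixCount_flipPath, fixCount_zero]
  · rintro s t hs hst hc ⟨n, b, hn, hb, hnb⟩
    have hc' : ∀ u ∈ Ico s t, flipPath w u = flipPath w s := fun u hu => by
      simp only [flipPath, hc u hu]
    have hfix := isFixTime_iff_of_const hst hc
    have hbreak := isFixTime_iff_of_const hst hc'
    simp only [flipPath_eq_working, flipPath_eq_broken] at hbreak
    rw [← fixCount_flipPath] at hb ⊢
    rcases hws : w s with _ | _ <;> rcases hwt : w t with _ | _ <;>
      simp only [hws, hwt, reduceCtorEq, and_false, and_true, iff_false, iff_true, if_true,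
        if_false] at hfix hbreak hnb ⊢
    · rw [fixCount_of_const_of_not_isFixTime hst hc hfix,
        fixCount_of_const_of_not_isFixTime hst hc' hbreak]
      exact ⟨n, b, hn, hb, hnb⟩
    · rw [fixCount_of_const_of_not_isFixTime hst hc hfix,
        fixCount_of_const_of_isFixTime hs hst hc' hbreak]
      exact ⟨n, b + 1, hn, by simp [hb], by omega⟩
    · rw [fixCount_of_const_of_isFixTime hs hst hc hfix,
        fixCount_of_const_of_not_isFixTime hst hc' hbreak]
      exact ⟨n + 1, b, by simp [hn], hb, by omega⟩
    · rw [fixCount_of_const_of_not_isFixTime hst hc hfix,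
        fixCount_of_const_of_not_isFixTime hst hc' hbreak]
      exact ⟨n, b, hn, hb, hnb⟩

/-- Just before the fix that raises the count from `j` to `j + 1`, the machine is broken and the
count is still `j`. -/
theorem IsRegularPath.lifespanCompleted (hw : IsRegularPath w) {t : ℝ} (ht : 0 ≤ t) {j : ℕ}
    (hj : (j : ℕ∞) < fixCount w t) : LifespanCompleted w j := by
  revert hj
  refine hw.induction (p := fun t => (j : ℕ∞) < fixCount w t → LifespanCompleted w j) ?_ ?_ t ht
  · simp [fixCount_zero]
  · intro s t hs hst hc ih hj
    by_cases hf : IsFixTime w t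
    · rw [fixCount_of_const_of_isFixTime hs hst hc hf] at hj
      have hle := Order.le_of_lt_add_one hj
      rcases hle.eq_or_lt with h | h
      · have hm : (s + t) / 2 ∈ Ioo s t := ⟨by linarith, by linarith⟩
        have hc' : ∀ u ∈ Ico s ((s + t) / 2), w u = w s :=
          fun u hu => hc u ⟨hu.1, hu.2.trans hm.2⟩
        -- The midpoint rather than `s`, because `s` may be `0` and the witness must be positive.
        refine ⟨(s + t) / 2, by linarith, ?_, ?_⟩
        · rw [hc _ ⟨hm.1.le, hm.2⟩]
          exact ((isFixTime_iff_of_const hst hc).1 hf).2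
        · rw [h, fixCount_of_const_of_not_isFixTime hm.1 hc' (not_isFixTime_of_const hc hm)]
      · exact ih h
    · rw [fixCount_of_const_of_not_isFixTime hst hc hf] at hj
      exact ih hj

theorem measurableSet_workingSpell (hm : Measurable w) (i : ℕ) :
    MeasurableSet (workingSpell w i) := by
  -- A level set of a monotone function is order-connected, hence Borel.
  have h1 : MeasurableSet {t | fixCount w t = i} := by
    refine OrdConnected.measurableSet ⟨fun x hx y hy z hz => ?_⟩
    exact le_antisymm ((fixCount_mono w hz.2).trans_eq hy)
      ((show fixCount w x = i from hx).symm.trans_le (fixCount_mono w hz.1))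
  have h2 : MeasurableSet {t | w t = .working} :=
    hm (MeasurableSet.of_discrete (s := {MachineState.working}))
  exact (measurableSet_Ioi (a := (0 : ℝ))).inter (h2.inter h1)

/-- The cover includes the residual spell `0` and the whole of the spell `n`, which may last beyond
`T`. The measure is arbitrary so that the bound serves both for time and for cumulative
contributions. -/
theorem measure_working_le_sum (μ : Measure ℝ) {T : ℝ} {n : ℕ} (hn : fixCount w T = n) :
    μ {t | t ∈ Ioc 0 T ∧ w t = .working} ≤ ∑ i ∈ Finset.range (n + 1), μ (workingSpell w i) := by
  refine (measure_mono ?_).trans (measure_biUnion_finset_le _ _)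
  rintro t ⟨ht, hwt⟩
  have hle : fixCount w t ≤ n := hn ▸ fixCount_mono w ht.2
  obtain ⟨k, hk⟩ := ENat.ne_top_iff_exists.1 (hle.trans_lt (ENat.natCast_lt_top n)).ne
  rw [← hk, Nat.cast_le] at hle
  simp only [mem_iUnion, Finset.mem_range]
  exact ⟨k, by omega, ht.1, hwt, hk.symm⟩

/-- Only the spells `1, …, n - 1` are certain to lie within `(0, T]`: the spell `0` is residual and
the spell `n` may last beyond `T`. -/
theorem sum_le_measure_working (hm : Measurable w) (μ : Measure ℝ) {T : ℝ} {n : ℕ}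
    (hn : fixCount w T = n) :
    ∑ i ∈ Finset.range (n - 1), μ (workingSpell w (i + 1)) ≤
      μ {t | t ∈ Ioc 0 T ∧ w t = .working} := by
  rw [← measure_biUnion_finset]
  · refine measure_mono ?_
    simp only [iUnion_subset_iff, Finset.mem_range]
    rintro i hi t ⟨h0, hwt, hc⟩
    refine ⟨⟨h0, ?_⟩, hwt⟩
    by_contra hT
    have := fixCount_mono w (not_le.1 hT).le
    rw [hn, hc, Nat.cast_le] at this
    omega
  · rintro i - j - hij
    refine Set.disjoint_left.2 ?_
    rintro t ⟨-, -, h1⟩ ⟨-, -, h2⟩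
    rw [h1, Nat.cast_inj] at h2
    omega
  · exact fun i _ => measurableSet_workingSpell hm _

/-! ### Alternating paths -/

/-- The path works on the intervals `[a n, b n)` and is broken on the intervals
`[b n, a (n + 1))`. -/
structure IsAlternating (w : ℝ → MachineState) (a b : ℤ → ℝ) : Prop where
  lt_end : ∀ n, a n < b n
  lt_next : ∀ n, b n < a (n + 1)
  tendsto_atTop : Tendsto a atTop atTop
  tendsto_atBot : Tendsto a atBot atBot
  working_iff : ∀ t, w t = .working ↔ ∃ n, a n ≤ t ∧ t < b n

namespace IsAlternating

variable {a b : ℤ → ℝ} (h : IsAlternating w a b)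
include h

theorem strictMono : StrictMono a :=
  strictMono_int_of_lt_succ fun n => (h.lt_end n).trans (h.lt_next n)

theorem exists_mem (t : ℝ) : ∃ n, a n ≤ t ∧ t < a (n + 1) := by
  obtain ⟨N, hN⟩ := (h.tendsto_atTop.eventually_gt_atTop t).exists
  obtain ⟨m, hm⟩ := (h.tendsto_atBot.eventually_le_atBot t).exists
  obtain ⟨n, hn1, hn2⟩ := Int.exists_greatest_of_bdd (P := fun n => a n ≤ t)
    ⟨N, fun n hn => by
      by_contra hlt
      exact absurd (h.strictMono.monotone (not_le.1 hlt).le) (not_le.2 (hn.trans_lt hN))⟩ ⟨m, hm⟩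
  refine ⟨n, hn1, ?_⟩
  by_contra hlt
  exact absurd (hn2 _ (not_lt.1 hlt)) (by omega)

theorem unique {t : ℝ} {m n : ℤ} (hm : a m ≤ t) (hm' : t < a (m + 1)) (hn : a n ≤ t)
    (hn' : t < a (n + 1)) : m = n := by
  have h1 := h.strictMono.lt_iff_lt.1 (hm.trans_lt hn')
  have h2 := h.strictMono.lt_iff_lt.1 (hn.trans_lt hm')
  omega

theorem working_iff_lt {t : ℝ} {n : ℤ} (hn : a n ≤ t) (hn' : t < a (n + 1)) :
    w t = .working ↔ t < b n := by
  rw [h.working_iff]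
  constructor
  · rintro ⟨m, h1, h2⟩
    obtain rfl := h.unique h1 (h2.trans (h.lt_next m)) hn hn'
    exact h2
  · exact fun h1 => ⟨n, hn, h1⟩

/-- With the breakdowns as starting points the structure is the same, so the formulas for working
spells below also give the broken spells. -/
theorem flip : IsAlternating (flipPath w) b (fun n => a (n + 1)) where
  lt_end := h.lt_next
  lt_next n := h.lt_end (n + 1)
  tendsto_atTop := tendsto_atTop_mono (fun n => (h.lt_end n).le) h.tendsto_atTop
  tendsto_atBot := tendsto_atBot_mono (fun n => (h.lt_next n).le)
    (h.tendsto_atBot.comp (tendsto_atBot_add_const_right _ 1 tendsto_id))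
  working_iff t := by
    rw [flipPath_eq_working, ← MachineState.ne_working]
    constructor
    · intro hw
      obtain ⟨n, h1, h2⟩ := h.exists_mem t
      exact ⟨n, not_lt.1 fun h3 => hw ((h.working_iff_lt h1 h2).2 h3), h2⟩
    · rintro ⟨n, h1, h2⟩ hw
      exact absurd ((h.working_iff_lt ((h.lt_end n).le.trans h1) h2).1 hw) (not_lt.2 h1)

theorem broken_of_mem {t : ℝ} {n : ℤ} (h1 : b n ≤ t) (h2 : t < a (n + 1)) : w t = .broken :=
  flipPath_eq_working.1 ((h.flip.working_iff t).2 ⟨n, h1, h2⟩)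

theorem working_of_mem {t : ℝ} {n : ℤ} (h1 : a n ≤ t) (h2 : t < b n) : w t = .working :=
  (h.working_iff t).2 ⟨n, h1, h2⟩

theorem regular_of_working {t : ℝ} (ht : w t = .working) :
    (∀ᶠ s in 𝓝[>] t, w s = w t) ∧ ∃ v, ∀ᶠ s in 𝓝[<] t, w s = v := by
  obtain ⟨n, h1, h2⟩ := (h.working_iff t).1 ht
  constructor
  · filter_upwards [Ioo_mem_nhdsGT h2] with s hs
    rw [ht, h.working_of_mem (h1.trans hs.1.le) hs.2]
  · rcases h1.eq_or_lt with h3 | h3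
    · refine ⟨.broken, ?_⟩
      have h4 : b (n - 1) < t := by
        have := h.lt_next (n - 1)
        rwa [sub_add_cancel, h3] at this
      filter_upwards [Ioo_mem_nhdsLT h4] with s hs
      exact h.broken_of_mem hs.1.le (by rw [sub_add_cancel, h3]; exact hs.2)
    · refine ⟨.working, ?_⟩
      filter_upwards [Ioo_mem_nhdsLT h3] with s hs
      exact h.working_of_mem hs.1.le (hs.2.trans h2)

theorem isRegularPath : IsRegularPath w := by
  intro t
  rcases hw : w t with _ | _
  · rw [← hw]
    exact h.regular_of_working hw
  · obtain ⟨h1, v, h2⟩ := h.flip.regular_of_working (flipPath_eq_working.2 hw)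
    refine ⟨h1.mono fun s hs => ?_, v.flip, h2.mono fun s hs => ?_⟩
    · rw [flipPath_eq_working.2 hw, flipPath_eq_working] at hs
      exact hs
    · rw [← hs]
      cases hs : w s <;> simp [flipPath, hs, MachineState.flip]

theorem isFixTime_iff {s : ℝ} : IsFixTime w s ↔ ∃ n, s = a n := by
  constructor
  · rintro ⟨h1, h2⟩
    obtain ⟨n, h3, h4⟩ := (h.working_iff s).1 h1
    refine ⟨n, ?_⟩
    by_contra hne
    have h5 : a n < s := lt_of_le_of_ne h3 (Ne.symm hne)
    obtain ⟨u, hu1, hu2⟩ := (h2.and (Ioo_mem_nhdsLT h5)).exists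
    rw [h.working_of_mem hu2.1.le (hu2.2.trans h4)] at hu1
    cases hu1
  · rintro ⟨n, rfl⟩
    refine ⟨h.working_of_mem le_rfl (h.lt_end n), ?_⟩
    have h4 : b (n - 1) < a n := by
      have := h.lt_next (n - 1)
      rwa [sub_add_cancel] at this
    filter_upwards [Ioo_mem_nhdsLT h4] with s hs
    exact h.broken_of_mem hs.1.le (by rw [sub_add_cancel]; exact hs.2)

/-- The index `k` marks the last fix up to time `0`, so the fixes in `(0, t]` are `a (k + 1), …, a
(k + i)`. -/
theorem fixCount_eq {k : ℤ} (hk : a k ≤ 0) (hk' : 0 < a (k + 1)) {i : ℕ} {t : ℝ}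
    (h1 : a (k + i) ≤ t) (h2 : t < a (k + i + 1)) : fixCount w t = i := by
  have : {s | s ∈ Ioc 0 t ∧ IsFixTime w s} = a '' (Finset.Ioc k (k + i) : Finset ℤ) := by
    ext s
    simp only [mem_ofPred_eq, h.isFixTime_iff, mem_image, Finset.coe_Ioc]
    constructor
    · rintro ⟨⟨h3, h4⟩, n, rfl⟩
      have h5 := h.strictMono.lt_iff_lt.1 (hk.trans_lt h3)
      have h6 := h.strictMono.lt_iff_lt.1 (h4.trans_lt h2)
      exact ⟨n, ⟨h5, by omega⟩, rfl⟩
    · rintro ⟨n, ⟨h3, h4⟩, rfl⟩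
      exact ⟨⟨hk'.trans_le (h.strictMono.monotone (by omega)),
        (h.strictMono.monotone h4).trans h1⟩, n, rfl⟩
  rw [fixCount, this, h.strictMono.injective.encard_image, encard_coe_eq_coe_finsetCard]
  simp

theorem workingSpell_eq {k : ℤ} (hk : a k ≤ 0) (hk' : 0 < a (k + 1)) (i : ℕ) :
    workingSpell w i = Ioi 0 ∩ Ico (a (k + i)) (b (k + i)) := by
  ext t
  constructor
  · rintro ⟨h0, hw, hc⟩
    obtain ⟨n, h1, h2⟩ := h.exists_mem t
    have hkn : k < n + 1 := h.strictMono.lt_iff_lt.1 ((hk.trans_lt h0).trans h2)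
    obtain ⟨j, rfl⟩ := Int.le.dest (show k ≤ n by omega)
    rw [h.fixCount_eq hk hk' h1 h2, Nat.cast_inj] at hc
    subst hc
    exact ⟨h0, h1, (h.working_iff_lt h1 h2).1 hw⟩
  · rintro ⟨h0, h1, h2⟩
    exact ⟨h0, h.working_of_mem h1 h2, h.fixCount_eq hk hk' h1 (h2.trans (h.lt_next _))⟩

theorem workingSpell_succ {k : ℤ} (hk : a k ≤ 0) (hk' : 0 < a (k + 1)) (i : ℕ) :
    workingSpell w (i + 1) = Ico (a (k + i + 1)) (b (k + i + 1)) := by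
  rw [h.workingSpell_eq hk hk', inter_eq_right.2, Nat.cast_add, Nat.cast_one, ← add_assoc]
  exact fun t ht => hk'.trans_le ((h.strictMono.monotone (by push_cast; omega)).trans ht.1)

end IsAlternating

/-! ### Long-run balance along a path -/

/-- The constant `K` absorbs the finitely many early terms. A bound for all `n` is needed because it
will be used at the random counts of spells, which may stay bounded. -/
theorem exists_abs_sub_le_of_tendsto_div {A : ℕ → ℝ} {c : ℝ}
    (hA : Tendsto (fun n : ℕ => A n / n) atTop (𝓝 c)) {ε : ℝ} (hε : 0 < ε) :
    ∃ K, 0 ≤ K ∧ ∀ n : ℕ, |A n - c * n| ≤ ε * n + K := by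
  obtain ⟨n₀, hn₀⟩ := Metric.tendsto_atTop.1 hA ε hε
  refine ⟨∑ n ∈ Finset.range (n₀ + 1), |A n - c * n|, Finset.sum_nonneg fun _ _ => abs_nonneg _,
    fun n => ?_⟩
  rcases lt_or_ge n (n₀ + 1) with h | h
  · have h1 := Finset.single_le_sum (f := fun n : ℕ => |A n - c * n|)
      (fun _ _ => abs_nonneg _) (Finset.mem_range.2 h)
    have : 0 ≤ ε * n := by positivity
    linarith
  · have hpos : (0 : ℝ) < n := by
      have : 0 < n := by omega
      exact_mod_cast this
    have h1 := hn₀ n (by omega)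
    rw [Real.dist_eq] at h1
    have h2 : A n - c * n = (A n / n - c) * n := by field_simp
    rw [h2, abs_mul, abs_of_pos hpos]
    have h3 : |A n / n - c| * n ≤ ε * n := by gcongr
    have h4 : 0 ≤ ∑ n ∈ Finset.range (n₀ + 1), |A n - c * n| :=
      Finset.sum_nonneg fun _ _ => abs_nonneg _
    linarith

/-- If the cumulative working time and the cumulative contribution are up to bounded errors the
sums of about equally many lifespans and quanta, then they balance in the long run. -/
theorem tendsto_balance {ρ K : ℝ} (hρ : 0 < ρ) {l m : ℕ → ℝ}
    (hl : Tendsto (fun n : ℕ => (∑ i ∈ Finset.range n, l i) / n) atTop (𝓝 (1 / ρ)))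
    (hm : Tendsto (fun n : ℕ => (∑ i ∈ Finset.range n, m i) / n) atTop (𝓝 1))
    {W C : ℕ → ℝ} {N B : ℕ → ℕ}
    (hW : ∀ T, ∑ i ∈ Finset.range (N T - 1), l i ≤ W T)
    (hW' : ∀ T, W T ≤ K + ∑ i ∈ Finset.range (N T), l i)
    (hC : ∀ T, ∑ i ∈ Finset.range (B T - 1), m i ≤ C T)
    (hC' : ∀ T, C T ≤ K + ∑ i ∈ Finset.range (B T), m i)
    (hNB : ∀ T, N T ≤ B T + 1) (hBN : ∀ T, B T ≤ N T + 1) (hWT : ∀ T : ℕ, W T ≤ T) :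
    Tendsto (fun T : ℕ => (ρ * W T - C T) / T) atTop (𝓝 0) := by
  have hl' : Tendsto (fun n : ℕ => (ρ * ∑ i ∈ Finset.range n, l i) / n) atTop (𝓝 1) := by
    have := hl.const_mul ρ
    rw [mul_one_div_cancel hρ.ne'] at this
    simpa only [mul_div_assoc] using this
  rw [Metric.tendsto_atTop]
  intro δ hδ
  -- The bound `1 / 2` lets the count be controlled by the time elapsed; the other bound makes the
  -- final error rate `4 * ε * ρ` at most `δ / 2`.
  set ε := min (1 / 2) (δ / (8 * ρ)) with hεdef
  have hε : 0 < ε := by positivity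
  have hε2 : ε ≤ 1 / 2 := min_le_left _ _
  have hερ : 4 * ε * ρ ≤ δ / 2 := by
    have : ε ≤ δ / (8 * ρ) := min_le_right _ _
    rw [le_div_iff₀ (by positivity)] at this
    linarith
  obtain ⟨K₁, hK₁, h₁⟩ := exists_abs_sub_le_of_tendsto_div hl' hε
  obtain ⟨K₂, hK₂, h₂⟩ := exists_abs_sub_le_of_tendsto_div hm hε
  set K' : ℝ := |K| + ρ * |K| + 4 * K₁ + K₂ + 5
  -- Each of `ρ * W T` and `C T` is within `ε * N T` plus a constant of `N T`, and `N T` is at most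
  -- `2 * ρ * T` plus a constant.
  have hbound : ∀ T : ℕ, |ρ * W T - C T| ≤ 4 * ε * ρ * T + K' := by
    intro T
    have a1 := abs_le.1 (h₁ (N T))
    have a2 := abs_le.1 (h₁ (N T - 1))
    have a3 := abs_le.1 (h₂ (B T))
    have a4 := abs_le.1 (h₂ (B T - 1))
    have b1 : ((N T - 1 : ℕ) : ℝ) ≤ N T := by exact_mod_cast Nat.sub_le _ _
    have b2 : (N T : ℝ) ≤ ((N T - 1 : ℕ) : ℝ) + 1 := by
      have : N T ≤ (N T - 1) + 1 := by omega
      exact_mod_cast this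
    have b3 : ((B T - 1 : ℕ) : ℝ) ≤ B T := by exact_mod_cast Nat.sub_le _ _
    have b4 : (B T : ℝ) ≤ ((B T - 1 : ℕ) : ℝ) + 1 := by
      have : B T ≤ (B T - 1) + 1 := by omega
      exact_mod_cast this
    have b5 : (N T : ℝ) ≤ B T + 1 := by exact_mod_cast hNB T
    have b6 : (B T : ℝ) ≤ N T + 1 := by exact_mod_cast hBN T
    have c1 := mul_le_mul_of_nonneg_left (hW T) hρ.le
    have c2 := mul_le_mul_of_nonneg_left (hW' T) hρ.le
    have c3 := mul_le_mul_of_nonneg_left (hWT T) hρ.le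
    have d1 := mul_le_mul_of_nonneg_left b1 hε.le
    have d3 := mul_le_mul_of_nonneg_left b3 hε.le
    have d6 := mul_le_mul_of_nonneg_left b6 hε.le
    have e1 : ρ * K ≤ ρ * |K| := mul_le_mul_of_nonneg_left (le_abs_self K) hρ.le
    have e2 := le_abs_self K
    have hK0 := abs_nonneg K
    have hρK : 0 ≤ ρ * |K| := by positivity
    have hN0 : (0 : ℝ) ≤ N T := Nat.cast_nonneg _
    have hT0 : (0 : ℝ) ≤ ρ * T := by positivity
    -- The completed lifespans fit into `T`, and `ρ` times their sum is at least `(1 - ε) * (N T -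
    -- 1) - K₁`, with `1 - ε ≥ 1 / 2`.
    have f1 : (N T : ℝ) ≤ 2 * (ρ * T) + 2 * K₁ + 2 := by
      have : ε * ((N T - 1 : ℕ) : ℝ) ≤ 1 / 2 * ((N T - 1 : ℕ) : ℝ) :=
        mul_le_mul_of_nonneg_right hε2 (Nat.cast_nonneg _)
      linarith
    have f2 := mul_le_mul_of_nonneg_left f1 hε.le
    have f3 : ε * K₁ ≤ 1 / 2 * K₁ := mul_le_mul_of_nonneg_right hε2 hK₁
    rw [mul_add] at c2 d6
    rw [abs_le]
    constructor <;> simp only [K'] <;> linarith [hC T, hC' T]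
  have hlim : Tendsto (fun T : ℕ => K' / (T : ℝ)) atTop (𝓝 0) :=
    tendsto_const_div_atTop_nhds_zero_nat K'
  obtain ⟨T₀, hT₀⟩ := (hlim.eventually (gt_mem_nhds (half_pos hδ))).exists_forall_of_atTop
  refine ⟨T₀ + 1, fun T hT => ?_⟩
  have hpos : (0 : ℝ) < T := by
    have : 0 < T := by omega
    exact_mod_cast this
  rw [Real.dist_eq, sub_zero, abs_div, abs_of_pos hpos, div_lt_iff₀ hpos]
  have h1 := hT₀ T (by omega)
  rw [div_lt_iff₀ hpos] at h1
  have h2 := mul_le_mul_of_nonneg_right hερ hpos.le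
  linarith [hbound T]

/-- The upper bound needs only that spells do not exceed their draws. The lower bound needs
equality, but only for the spells `1, …, n - 1`, which are completed because a later fix has
occurred. -/
theorem working_measure_bounds {w : ℝ → MachineState} (hw : IsRegularPath w) (hm : Measurable w)
    (μ : Measure ℝ) {l : ℕ → ℝ≥0} (h0 : μ (workingSpell w 0) ≠ ∞)
    (hl : ∀ i : ℕ, μ (workingSpell w (i + 1)) ≤ l i ∧
      (LifespanCompleted w (i + 1) → μ (workingSpell w (i + 1)) = l i))
    {T : ℝ} (hT : 0 ≤ T) {n : ℕ} (hn : fixCount w T = n) :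
    ∑ i ∈ Finset.range (n - 1), (l i : ℝ) ≤ μ.real {t | t ∈ Ioc 0 T ∧ w t = .working} ∧
    μ.real {t | t ∈ Ioc 0 T ∧ w t = .working} ≤
      μ.real (workingSpell w 0) + ∑ i ∈ Finset.range n, (l i : ℝ) := by
  have hup : μ {t | t ∈ Ioc 0 T ∧ w t = .working} ≤
      μ (workingSpell w 0) + ∑ i ∈ Finset.range n, (l i : ℝ≥0∞) := by
    refine (measure_working_le_sum μ hn).trans ?_
    rw [Finset.sum_range_succ', add_comm]
    gcongr with i _
    exact (hl i).1
  have hfin : μ (workingSpell w 0) + ∑ i ∈ Finset.range n, (l i : ℝ≥0∞) ≠ ∞ :=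
    ENNReal.add_ne_top.2 ⟨h0, ENNReal.sum_ne_top.2 fun _ _ => ENNReal.coe_ne_top⟩
  have hlow : ∑ i ∈ Finset.range (n - 1), (l i : ℝ≥0∞) ≤
      μ {t | t ∈ Ioc 0 T ∧ w t = .working} := by
    refine le_trans (le_of_eq ?_) (sum_le_measure_working hm μ hn)
    refine Finset.sum_congr rfl fun i hi => ((hl i).2 (hw.lifespanCompleted hT ?_)).symm
    rw [hn, Nat.cast_lt]
    have := Finset.mem_range.1 hi
    omega
  constructor
  · have := ENNReal.toReal_mono (ne_top_of_le_ne_top hfin hup) hlow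
    rw [ENNReal.toReal_sum fun _ _ => ENNReal.coe_ne_top] at this
    exact this
  · have := ENNReal.toReal_mono hfin hup
    rw [ENNReal.toReal_add h0 (ENNReal.sum_ne_top.2 fun _ _ => ENNReal.coe_ne_top),
      ENNReal.toReal_sum fun _ _ => ENNReal.coe_ne_top] at this
    exact this

/-- A coupling turns almost sure properties into almost sure existence. -/
theorem ae_exists_of_coupling {S Ω : Type*} [MeasurableSpace S] [MeasurableSpace Ω]
    [StandardBorelSpace Ω] {P : Measure S} {Q : Measure Ω} [IsProbabilityMeasure P]
    {γ : Measure (S × Ω)} (h1 : γ.map Prod.fst = P) (h2 : γ.map Prod.snd = Q)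
    {r : S → Ω → Prop} {g : Ω → Prop} (hr : ∀ᵐ q ∂γ, r q.1 q.2) (hg : ∀ᵐ y ∂Q, g y) :
    ∀ᵐ x ∂P, ∃ y, r x y ∧ g y := by
  have hγ : IsProbabilityMeasure γ := by
    constructor
    rw [← preimage_univ (f := Prod.fst), ← Measure.map_apply measurable_fst MeasurableSet.univ, h1,
      measure_univ]
  have hne : Nonempty Ω := by
    obtain ⟨q⟩ := nonempty_of_isProbabilityMeasure γ
    exact ⟨q.2⟩
  rw [← h2] at hg
  have hg' := ae_of_ae_map measurable_snd.aemeasurable hg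
  -- For almost every `x` the property holds almost surely under the conditional law given `x`; this
  -- is a probability measure, so some `y` has the property.
  have hboth : ∀ᵐ q ∂γ, r q.1 q.2 ∧ g q.2 := hr.and hg'
  rw [← γ.disintegrate γ.condKernel] at hboth
  have := Measure.ae_ae_of_ae_compProd hboth
  rw [Measure.fst, h1] at this
  filter_upwards [this] with x hx
  exact hx.exists

namespace SystemProcess

variable {Θ : Type*} [MeasurableSpace Θ] {S : Type*} [MeasurableSpace S]
  (X : SystemProcess Θ S) (M : FluidModel Θ)

/-! ### Averages over ages and types -/

section Averages

variable {f : ℝ → S → Θ → ℝ≥0 → unitInterval}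
  (hf : Measurable (fun q : ℝ × S × Θ × ℝ≥0 => f q.1 q.2.1 q.2.2.1 q.2.2.2))

include hf in
theorem measurable_average :
    Measurable (fun q : ℝ × S × Θ => ∫ z, (f q.1 q.2.1 q.2.2 z : ℝ) ∂(M.ageLaw q.2.2)) := by
  have h : StronglyMeasurable (Function.uncurry fun (q : ℝ × S × Θ) (z : ℝ≥0) =>
      (f q.1 q.2.1 q.2.2 z : ℝ)) := by
    refine Measurable.stronglyMeasurable (measurable_subtype_coe.comp ?_)
    exact hf.comp (f := fun p : (ℝ × S × Θ) × ℝ≥0 => (p.1.1, p.1.2.1, p.1.2.2, p.2)) (by fun_prop)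
  have := StronglyMeasurable.integral_kernel_prod_right
    (κ := M.ageKernel.comap (fun q : ℝ × S × Θ => q.2.2) (by fun_prop)) h
  simpa only [Kernel.comap_apply, M.ageKernel_apply] using this.measurable

theorem integrable_unitInterval {α : Type*} [MeasurableSpace α] {μ : Measure α}
    [IsFiniteMeasure μ] {g : α → ℝ} (hg : AEStronglyMeasurable g μ)
    (h : ∀ x, g x ∈ Icc (0 : ℝ) 1) : Integrable g μ :=
  Integrable.of_bound hg 1 (Eventually.of_forall fun x => by
    rw [Real.norm_eq_abs, abs_of_nonneg (h x).1]
    exact (h x).2)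

theorem integral_mem_unitInterval {α : Type*} [MeasurableSpace α] {μ : Measure α}
    [IsProbabilityMeasure μ] {g : α → ℝ} (h : ∀ x, g x ∈ Icc (0 : ℝ) 1) :
    ∫ x, g x ∂μ ∈ Icc (0 : ℝ) 1 := by
  refine ⟨integral_nonneg fun x => (h x).1, ?_⟩
  refine (integral_mono_of_nonneg (Eventually.of_forall fun x => (h x).1)
    (integrable_const (1 : ℝ)) (Eventually.of_forall fun x => (h x).2)).trans ?_
  simp

omit [MeasurableSpace S] in
theorem average_mem_unitInterval (t : ℝ) (x : S) (θ : Θ) :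
    ∫ z, (f t x θ z : ℝ) ∂(M.ageLaw θ) ∈ Icc (0 : ℝ) 1 := by
  have := M.isProbabilityMeasure_ageLaw θ
  exact integral_mem_unitInterval fun z => (f t x θ z).2

include hf in
-- Fubini reduces the claim to a fixed age. This detour is needed because the product σ-algebra on
-- function spaces sees only countably many coordinates at once, so that stationarity applies to the
-- level at one age but not directly to the average over ages.
theorem integral_average_eq {t : ℝ} {θ : Θ}
    (h : ∀ z, ∫ x, (f t x θ z : ℝ) ∂X.prob = ∫ x, (f 0 x θ z : ℝ) ∂X.prob) :
    ∫ x, ∫ z, (f t x θ z : ℝ) ∂(M.ageLaw θ) ∂X.prob =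
      ∫ x, ∫ z, (f 0 x θ z : ℝ) ∂(M.ageLaw θ) ∂X.prob := by
  have := X.isProb
  have := M.isProbabilityMeasure_ageLaw θ
  have hint : ∀ t, Integrable (Function.uncurry fun x z => (f t x θ z : ℝ))
      (X.prob.prod (M.ageLaw θ)) := fun t => by
    refine integrable_unitInterval (Measurable.aestronglyMeasurable ?_) fun q => (f t q.1 θ q.2).2
    exact measurable_subtype_coe.comp
      (hf.comp (f := fun p : S × ℝ≥0 => (t, p.1, θ, p.2)) (by fun_prop))
  rw [integral_integral_swap (hint t), integral_integral_swap (hint 0)]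
  exact integral_congr_ae (Eventually.of_forall h)

end Averages

variable {X M}

theorem measurable_state_left (x : S) : Measurable fun t => X.state t x :=
  X.measurable_state.comp (f := fun t => (t, x)) (by fun_prop)

theorem measurable_state_right (t : ℝ) : Measurable (X.state t) :=
  X.measurable_state.comp (f := fun x => (t, x)) (by fun_prop)

theorem measurableSet_state (v : MachineState) : MeasurableSet {q : ℝ × S | X.state q.1 q.2 = v} :=
  X.measurable_state (MeasurableSet.of_discrete (s := {v}))

theorem measurableSet_state_right (t : ℝ) (v : MachineState) :
    MeasurableSet {x : S | X.state t x = v} :=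
  X.measurable_state_right t (MeasurableSet.of_discrete (s := {v}))

theorem measurable_avgContribution :
    Measurable (fun q : ℝ × S × Θ => X.avgContribution M q.1 q.2.1 q.2.2) :=
  measurable_average M X.measurable_contribution

theorem measurable_avgUsage :
    Measurable (fun q : ℝ × S × Θ => X.avgUsage M q.1 q.2.1 q.2.2) :=
  measurable_average M X.measurable_usage

theorem avgUsage_mem (t : ℝ) (x : S) (θ : Θ) : X.avgUsage M t x θ ∈ Icc (0 : ℝ) 1 :=
  average_mem_unitInterval M t x θ

theorem avgContribution_mem (t : ℝ) (x : S) (θ : Θ) : X.avgContribution M t x θ ∈ Icc (0 : ℝ) 1 :=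
  average_mem_unitInterval M t x θ

theorem measurable_contributionRate :
    Measurable (fun q : ℝ × S => X.contributionRate M q.1 q.2) := by
  have := M.typeLaw_prob
  have h : StronglyMeasurable (fun p : (ℝ × S) × Θ => X.avgContribution M p.1.1 p.1.2 p.2) :=
    ((measurable_avgContribution (X := X) (M := M)).comp
      (f := fun p : (ℝ × S) × Θ => (p.1.1, p.1.2, p.2)) (by fun_prop)).stronglyMeasurable
  exact h.integral_prod_right'.measurable

theorem contributionRate_mem (t : ℝ) (x : S) : X.contributionRate M t x ∈ Icc (0 : ℝ) 1 := by
  have := M.typeLaw_prob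
  exact integral_mem_unitInterval fun θ => avgContribution_mem t x θ

/-! ### Necessity of the physical constraints -/

theorem IsStationary.integral_eq (hX : X.IsStationary) {g : SystemState Θ → ℝ} (hg : Measurable g)
    (t : ℝ) : ∫ x, g (X.value t x) ∂X.prob = ∫ x, g (X.value 0 x) ∂X.prob := by
  have h := ((hX t).comp (u := fun p : ℝ → SystemState Θ => g (p 0))
    (hg.comp (measurable_pi_apply 0))).integral_eq
  simpa [Function.comp_def] using h

theorem IsStationary.hasReducedForm (hX : X.IsStationary) :
    X.HasReducedForm M (X.reducedFormAt M 0) := by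
  have := X.isProb
  intro t
  have hR : (X.reducedFormAt M t).R = (X.reducedFormAt M 0).R := by
    funext θ
    exact integral_average_eq X M X.measurable_usage fun z =>
      hX.integral_eq (g := fun s => (s.2.1 θ z : ℝ)) (by fun_prop) t
  have hP : (X.reducedFormAt M t).P = (X.reducedFormAt M 0).P := by
    funext θ
    exact integral_average_eq X M X.measurable_contribution fun z =>
      hX.integral_eq (g := fun s => (s.2.2 θ z : ℝ)) (by fun_prop) t
  have hQ : (X.reducedFormAt M t).Q = (X.reducedFormAt M 0).Q := by
    have hg : Measurable fun s : SystemState Θ =>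
        ({MachineState.working} : Set MachineState).indicator (1 : MachineState → ℝ) s.1 :=
      (measurable_one.indicator MeasurableSet.of_discrete).comp measurable_fst
    have h := hX.integral_eq hg t
    have h' : ∀ t, ∫ x, ({MachineState.working} : Set MachineState).indicator
        (1 : MachineState → ℝ) (X.value t x).1 ∂X.prob = (X.reducedFormAt M t).Q := fun t => by
      rw [reducedFormAt, ← integral_indicator_one (measurableSet_state_right t _)]
      rfl
    rw [h', h'] at h
    exact h
  cases h : X.reducedFormAt M t
  cases h' : X.reducedFormAt M 0
  simp only [h, h'] at hR hP hQ
  simp [hR, hP, hQ]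

theorem tendsto_balance_path (x : S) (hreg : IsRegularPath (X.path x)) {l m : ℕ → ℝ≥0}
    (hl : X.LifespansAgree x l) (hm : X.QuantaAgree M x m)
    (hl0 : lifespan (X.path x) 0 < ∞) (hm0 : X.quantum M 0 x < ∞)
    (hl' : Tendsto (fun n : ℕ => (∑ i ∈ Finset.range n, (l i : ℝ)) / n) atTop (𝓝 (1 / M.ρ)))
    (hm' : Tendsto (fun n : ℕ => (∑ i ∈ Finset.range n, (m i : ℝ)) / n) atTop (𝓝 1))
    (hzero : ∀ t, X.state t x = .working → X.contributionRate M t x = 0) :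
    Tendsto (fun T : ℕ => (M.ρ * (∫ t in Ioc (0 : ℝ) T,
      {t | X.state t x = .working}.indicator (1 : ℝ → ℝ) t) -
        ∫ t in Ioc (0 : ℝ) T, X.contributionRate M t x) / T) atTop (𝓝 0) := by
  have hpm : Measurable (X.path x) := measurable_state_left x
  have hfm : Measurable (flipPath (X.path x)) :=
    (Measurable.of_discrete (f := MachineState.flip)).comp hpm
  have hrm : Measurable fun t => X.contributionRate M t x :=
    measurable_contributionRate.comp (f := fun t => (t, x)) (by fun_prop)
  have hset : ∀ T : ℝ, MeasurableSet {t | t ∈ Ioc 0 T ∧ flipPath (X.path x) t = .working} :=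
    fun T => measurableSet_Ioc.inter (hfm (MeasurableSet.of_discrete (s := {MachineState.working})))
  have hset' : MeasurableSet {t | X.state t x = .working} :=
    hpm (MeasurableSet.of_discrete (s := {MachineState.working}))
  -- Measured with the contribution rate as density, the quanta are the lifespans of the exchanged
  -- path, so the same spell bounds apply to them.
  set μ : Measure ℝ := volume.withDensity fun t => ENNReal.ofReal (X.contributionRate M t x)
  have hμ : ∀ i, μ (workingSpell (flipPath (X.path x)) i) = X.quantum M i x := fun i => by
    rw [withDensity_apply _ (measurableSet_workingSpell hfm i), workingSpell_flipPath]
    rfl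
  choose! N B hN hB hNB hBN using fun T : ℕ => hreg.exists_counts (Nat.cast_nonneg (α := ℝ) T)
  have hbW := fun T : ℕ => working_measure_bounds hreg hpm volume hl0.ne hl
    (Nat.cast_nonneg T) (hN T)
  have hbC := fun T : ℕ => working_measure_bounds hreg.flip hfm μ (l := m)
    (by rw [hμ]; exact hm0.ne) (fun i => by
      rw [hμ, lifespanCompleted_flipPath]
      exact hm i) (Nat.cast_nonneg T) (by rw [fixCount_flipPath]; exact hB T)
  have hWeq : ∀ T : ℕ, ∫ t in Ioc (0 : ℝ) T,
      {t | X.state t x = .working}.indicator (1 : ℝ → ℝ) t =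
        volume.real {t | t ∈ Ioc 0 (T : ℝ) ∧ X.path x t = .working} := fun T => by
    rw [integral_indicator_one hset', measureReal_restrict_apply hset', inter_comm]
    rfl
  have hCeq : ∀ T : ℕ, ∫ t in Ioc (0 : ℝ) T, X.contributionRate M t x =
        μ.real {t | t ∈ Ioc 0 (T : ℝ) ∧ flipPath (X.path x) t = .working} := fun T => by
    rw [measureReal_def, withDensity_apply _ (hset T), ← integral_eq_lintegral_of_nonneg_ae
      (Eventually.of_forall fun t => (contributionRate_mem t x).1) hrm.aestronglyMeasurable]
    -- Contributions vanish while the machine works, so integrating over broken times loses nothing.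
    refine setIntegral_eq_of_subset_of_forall_sdiff_eq_zero measurableSet_Ioc (fun t ht => ht.1) ?_
    rintro t ⟨ht1, ht2⟩
    refine hzero t ?_
    by_contra hne
    exact ht2 ⟨ht1, flipPath_eq_working.2 (MachineState.ne_working.1 hne)⟩
  simp only [hWeq, hCeq]
  refine tendsto_balance (K := max (volume.real (workingSpell (X.path x) 0))
      (μ.real (workingSpell (flipPath (X.path x)) 0))) M.ρ_pos hl' hm'
    (fun T => (hbW T).1) (fun T => (hbW T).2.trans ?_) (fun T => (hbC T).1)
    (fun T => (hbC T).2.trans ?_) hNB hBN (fun T => ?_)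
  · gcongr; exact le_max_left _ _
  · gcongr; exact le_max_right _ _
  · refine (measureReal_mono (s₂ := Ioc (0 : ℝ) T) (fun t ht => ht.1) (by simp)).trans ?_
    simp

theorem integral_setIntegral_of_const {g : ℝ × S → ℝ} (hg : Measurable g)
    (hg1 : ∀ q, g q ∈ Icc (0 : ℝ) 1) {c : ℝ} (hc : ∀ t, ∫ x, g (t, x) ∂X.prob = c) (T : ℕ) :
    ∫ x, (∫ t in Ioc (0 : ℝ) T, g (t, x)) ∂X.prob = T * c := by
  have := X.isProb
  rw [integral_integral_swap (f := fun x t => g (t, x)) (integrable_unitInterval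
    (hg.comp measurable_swap).aestronglyMeasurable fun q => hg1 _)]
  simp [hc]

omit [MeasurableSpace S] in
theorem setIntegral_mem {g : ℝ × S → ℝ} (hg1 : ∀ q, g q ∈ Icc (0 : ℝ) 1) (T : ℕ) (x : S) :
    ∫ t in Ioc (0 : ℝ) T, g (t, x) ∈ Icc (0 : ℝ) T := by
  refine ⟨integral_nonneg fun t => (hg1 _).1, ?_⟩
  refine (integral_mono_of_nonneg (Eventually.of_forall fun t => (hg1 _).1)
    (integrable_const (1 : ℝ)) (Eventually.of_forall fun t => (hg1 _).2)).trans ?_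
  simp

theorem IsAdmissible.contributionRate_eq_zero (hX : X.IsAdmissible M) :
    ∀ᵐ x ∂X.prob, ∀ t, X.state t x = .working → X.contributionRate M t x = 0 := by
  filter_upwards [hX.contribution_le] with x hx t ht
  have h : ∀ θ, X.avgContribution M t x θ = 0 := fun θ => by
    refine integral_eq_zero_of_ae (Eventually.of_forall fun z => ?_)
    refine le_antisymm ((hx t θ z).trans ?_) (X.contribution t x θ z).2.1
    rw [indicator_of_notMem]
    · rfl
    · simp [ht]
  simp [contributionRate, h]

/-- The lifespans and the quanta come with separate couplings. These need not be combined: for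
almost every path it suffices that some draws agree with the path and have the averages given by the
strong law. -/
theorem IsAdmissible.ae_tendsto_balance (hX : X.IsAdmissible M) :
    ∀ᵐ x ∂X.prob, Tendsto (fun T : ℕ => (M.ρ * (∫ t in Ioc (0 : ℝ) T,
      {t | X.state t x = .working}.indicator (1 : ℝ → ℝ) t) -
        ∫ t in Ioc (0 : ℝ) T, X.contributionRate M t x) / T) atTop (𝓝 0) := by
  have := X.isProb
  have := M.lifespanLaw_prob
  have := M.quantumLaw_prob
  obtain ⟨γ₁, hγ₁, hγ₁', hγ₁''⟩ := hX.lifespan_iid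
  obtain ⟨γ₂, hγ₂, hγ₂', hγ₂''⟩ := hX.quantum_iid
  have hl := ae_exists_of_coupling hγ₁ hγ₁' hγ₁'' (ae_tendsto_average_infinitePi M.lifespanLaw
    (one_div_nonneg.2 M.ρ_pos.le) M.lifespanLaw_mean)
  have hm := ae_exists_of_coupling hγ₂ hγ₂' hγ₂'' (ae_tendsto_average_infinitePi M.quantumLaw
    zero_le_one (by rw [M.quantumLaw_mean, ENNReal.ofReal_one]))
  filter_upwards [hl, hm, X.regular, hX.lifespan_residual, hX.quantum_residual,
    hX.contributionRate_eq_zero] with x ⟨l, hl1, hl2⟩ ⟨m, hm1, hm2⟩ hreg hl0 hm0 hz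
  exact tendsto_balance_path x hreg hl1 hm1 hl0 hm0 hl2 hm2 hz

theorem integral_contributionRate (t : ℝ) :
    ∫ x, X.contributionRate M t x ∂X.prob = ∫ θ, (X.reducedFormAt M t).P θ ∂M.typeLaw := by
  have := X.isProb
  have := M.typeLaw_prob
  refine integral_integral_swap (integrable_unitInterval
    (Measurable.aestronglyMeasurable ?_) fun q => avgContribution_mem t q.1 q.2)
  exact (measurable_avgContribution (X := X) (M := M)).comp
    (f := fun p : S × Θ => (t, p.1, p.2)) (by fun_prop)

theorem integral_working (t : ℝ) :
    ∫ x, {q : ℝ × S | X.state q.1 q.2 = .working}.indicator (1 : ℝ × S → ℝ) (t, x) ∂X.prob =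
      (X.reducedFormAt M t).Q := by
  rw [reducedFormAt, ← integral_indicator_one (measurableSet_state_right t _)]
  rfl

theorem IsAdmissible.balance (hX : X.IsAdmissible M) :
    M.ρ * (X.reducedFormAt M 0).Q = ∫ θ, (X.reducedFormAt M 0).P θ ∂M.typeLaw := by
  have := X.isProb
  have hρ := M.ρ_pos
  have hQ : ∀ t, (X.reducedFormAt M t).Q = (X.reducedFormAt M 0).Q := fun t => by
    rw [hX.stationary.hasReducedForm t]
  have hP : ∀ t, (X.reducedFormAt M t).P = (X.reducedFormAt M 0).P := fun t => by
    rw [hX.stationary.hasReducedForm t]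
  set g₁ : ℝ × S → ℝ := {q : ℝ × S | X.state q.1 q.2 = .working}.indicator 1 with hg₁
  set g₂ : ℝ × S → ℝ := fun q => X.contributionRate M q.1 q.2 with hg₂
  have hg₁m : Measurable g₁ := measurable_one.indicator (measurableSet_state _)
  have hg₂m : Measurable g₂ := measurable_contributionRate
  have hg₁1 : ∀ q, g₁ q ∈ Icc (0 : ℝ) 1 := fun q =>
    ⟨indicator_nonneg (fun _ _ => zero_le_one) q, indicator_le_self' (fun _ _ => zero_le_one) q⟩
  have hg₂1 : ∀ q, g₂ q ∈ Icc (0 : ℝ) 1 := fun q => contributionRate_mem q.1 q.2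
  set W : ℕ → S → ℝ := fun T x => ∫ t in Ioc (0 : ℝ) T, g₁ (t, x) with hW
  set C : ℕ → S → ℝ := fun T x => ∫ t in Ioc (0 : ℝ) T, g₂ (t, x) with hC
  have hWm : ∀ T, StronglyMeasurable (W T) := fun T =>
    StronglyMeasurable.integral_prod_left' (f := g₁) hg₁m.stronglyMeasurable
  have hCm : ∀ T, StronglyMeasurable (C T) := fun T =>
    StronglyMeasurable.integral_prod_left' (f := g₂) hg₂m.stronglyMeasurable
  have hWb : ∀ (T : ℕ) x, W T x ∈ Icc (0 : ℝ) T := setIntegral_mem hg₁1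
  have hCb : ∀ (T : ℕ) x, C T x ∈ Icc (0 : ℝ) T := setIntegral_mem hg₂1
  have hWI : ∀ T : ℕ, ∫ x, W T x ∂X.prob = T * (X.reducedFormAt M 0).Q := fun T =>
    integral_setIntegral_of_const hg₁m hg₁1 (fun t => by rw [← hQ t, ← integral_working]) T
  have hCI : ∀ T : ℕ, ∫ x, C T x ∂X.prob = T * ∫ θ, (X.reducedFormAt M 0).P θ ∂M.typeLaw :=
    fun T => integral_setIntegral_of_const hg₂m hg₂1
      (fun t => by rw [← hP t, ← integral_contributionRate]) T
  have hWint : ∀ T, Integrable (W T) X.prob := fun T =>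
    Integrable.of_bound (hWm T).aestronglyMeasurable T (Eventually.of_forall fun x => by
      rw [Real.norm_eq_abs, abs_of_nonneg (hWb T x).1]
      exact (hWb T x).2)
  have hCint : ∀ T, Integrable (C T) X.prob := fun T =>
    Integrable.of_bound (hCm T).aestronglyMeasurable T (Eventually.of_forall fun x => by
      rw [Real.norm_eq_abs, abs_of_nonneg (hCb T x).1]
      exact (hCb T x).2)
  -- Both `W T` and `C T` lie in `[0, T]`, so `ρ + 1` dominates the quotients.
  have hlim : Tendsto (fun T : ℕ => ∫ x, (M.ρ * W T x - C T x) / T ∂X.prob) atTop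
      (𝓝 (∫ _, 0 ∂X.prob)) := by
    refine tendsto_integral_of_dominated_convergence (fun _ => M.ρ + 1) (fun T => ?_)
      (integrable_const _) (fun T => Eventually.of_forall fun x => ?_) hX.ae_tendsto_balance
    · exact (((hWint T).const_mul M.ρ).sub (hCint T)).div_const _ |>.aestronglyMeasurable
    · rw [Real.norm_eq_abs, abs_div, abs_of_nonneg (Nat.cast_nonneg (α := ℝ) T)]
      refine div_le_of_le_mul₀ (Nat.cast_nonneg T) (by positivity) ?_
      have h1 := hWb T x
      have h2 := hCb T x
      have h3 := mul_le_mul_of_nonneg_left h1.2 hρ.le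
      have h4 := mul_nonneg hρ.le h1.1
      have h5 : 0 ≤ M.ρ * T := by positivity
      have h6 := h2.1
      have h7 := h2.2
      rw [abs_le]
      constructor <;> linarith
  -- By stationarity and Fubini the expectations are exactly proportional to `T`; only `T = 0` is
  -- excluded.
  have hconst : ∀ᶠ T : ℕ in atTop, ∫ x, (M.ρ * W T x - C T x) / T ∂X.prob =
      M.ρ * (X.reducedFormAt M 0).Q - ∫ θ, (X.reducedFormAt M 0).P θ ∂M.typeLaw := by
    filter_upwards [eventually_ge_atTop 1] with T hT
    have hT' : (T : ℝ) ≠ 0 := by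
      have : T ≠ 0 := by omega
      exact_mod_cast this
    rw [integral_div, integral_sub ((hWint T).const_mul _) (hCint T), integral_const_mul, hWI, hCI]
    field_simp
  have h0 := tendsto_nhds_unique hlim (tendsto_const_nhds.congr' (hconst.mono fun _ h => h.symm))
  simp only [integral_zero] at h0
  linarith

theorem prob_broken : X.prob.real {x | X.state 0 x = .broken} = 1 - (X.reducedFormAt M 0).Q := by
  have := X.isProb
  rw [reducedFormAt, ← probReal_compl_eq_one_sub (measurableSet_state_right 0 _)]
  congr 1
  ext x
  simp [← MachineState.ne_working]

theorem IsAdmissible.isPhysical (hX : X.IsAdmissible M) : (X.reducedFormAt M 0).IsPhysical M := by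
  have := X.isProb
  have avg_le : ∀ (v : MachineState) (f : S → ℝ≥0 → unitInterval) (θ : Θ),
      (∀ᵐ x ∂X.prob, ∀ z, (f x z : ℝ) ≤ {s | X.state s x = v}.indicator 1 (0 : ℝ)) →
      ∫ x, ∫ z, (f x z : ℝ) ∂(M.ageLaw θ) ∂X.prob ≤ X.prob.real {x | X.state 0 x = v} := by
    intro v f θ hf
    have := M.isProbabilityMeasure_ageLaw θ
    rw [← integral_indicator_one (measurableSet_state_right 0 v)]
    refine integral_mono_of_nonneg (Eventually.of_forall fun x =>
      integral_nonneg fun z => (f x z).2.1) ?_ ?_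
    · exact (integrable_const (1 : ℝ)).indicator (measurableSet_state_right 0 v)
    · filter_upwards [hf] with x hx
      refine (integral_mono_of_nonneg (Eventually.of_forall fun z => (f x z).2.1)
        (integrable_const _) (Eventually.of_forall hx)).trans ?_
      simp only [integral_const, probReal_univ, one_smul]
      exact le_rfl
  exact {
    measurable_R := by
      refine (StronglyMeasurable.integral_prod_left'
        (f := fun p : S × Θ => X.avgUsage M 0 p.1 p.2) ?_).measurable
      exact ((measurable_avgUsage (X := X) (M := M)).comp
        (f := fun p : S × Θ => ((0 : ℝ), p.1, p.2)) (by fun_prop)).stronglyMeasurable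
    measurable_P := by
      refine (StronglyMeasurable.integral_prod_left'
        (f := fun p : S × Θ => X.avgContribution M 0 p.1 p.2) ?_).measurable
      exact ((measurable_avgContribution (X := X) (M := M)).comp
        (f := fun p : S × Θ => ((0 : ℝ), p.1, p.2)) (by fun_prop)).stronglyMeasurable
    R_mem := fun θ => integral_mem_unitInterval fun x => avgUsage_mem 0 x θ
    P_mem := fun θ => integral_mem_unitInterval fun x => avgContribution_mem 0 x θ
    Q_mem := ⟨measureReal_nonneg, measureReal_le_one⟩
    balance := hX.balance
    simplex_R := fun θ => avg_le .working _ θ (hX.usage_le.mono fun x hx z => hx 0 θ z)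
    simplex_P := fun θ => by
      rw [← prob_broken]
      exact avg_le .broken _ θ (hX.contribution_le.mono fun x hx z => hx 0 θ z) }

end SystemProcess

/-! ### Sets determined by coordinates of a product space -/

/-- Membership in `D` is determined by the coordinates in `J`. -/
def DeterminedBy {ι : Type*} {E : ι → Type*} (D : Set (∀ i, E i)) (J : Set ι) : Prop :=
  ∀ y y' : ∀ i, E i, (∀ i ∈ J, y i = y' i) → (y ∈ D ↔ y' ∈ D)

/-- Events determined by disjoint sets of coordinates are independent. -/
theorem infinitePi_inter_eq_mul {ι E : Type*} [MeasurableSpace E] [Nonempty E]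
    (μ : ι → Measure E) [∀ i, IsProbabilityMeasure (μ i)] {J : Set ι} {D D' : Set (ι → E)}
    (hD : MeasurableSet D) (hD' : MeasurableSet D') (hJ : DeterminedBy D J)
    (hJ' : DeterminedBy D' Jᶜ) :
    Measure.infinitePi μ (D ∩ D') = Measure.infinitePi μ D * Measure.infinitePi μ D' := by
  classical
  obtain ⟨e⟩ := ‹Nonempty E›
  have key : ∀ (K : Set ι) (G : Set (ι → E)), MeasurableSet G → DeterminedBy G K →
      ∃ G', MeasurableSet G' ∧ G = K.domRestrict ⁻¹' G' := by
    intro K G hG hK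
    -- Filling the missing coordinates with the constant `e` does not affect membership, since `G`
    -- is determined by `K`.
    refine ⟨(fun z i => if h : i ∈ K then z ⟨i, h⟩ else e) ⁻¹' G, hG.preimage ?_, ?_⟩
    · refine measurable_pi_lambda _ fun i => ?_
      by_cases h : i ∈ K
      · simpa [h] using measurable_pi_apply _
      · simp [h]
    · ext y
      refine hK _ _ fun i hi => ?_
      simp [hi, domRestrict]
  obtain ⟨G, hG, rfl⟩ := key J D hD hJ
  obtain ⟨G', hG', rfl⟩ := key Jᶜ D' hD' hJ'
  exact (indepFun_domRestrict_compl_infinitePi μ J).measure_inter_preimage_eq_mul _ _ hG hG'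

/-! ### Averages over a random cycle -/

theorem setLIntegral_Ico_add (f : ℝ → ℝ≥0∞) (a b h : ℝ) :
    ∫⁻ s in Ico a b, f (s + h) = ∫⁻ s in Ico (a + h) (b + h), f s := by
  have := (measurePreserving_add_right volume h).setLIntegral_comp_preimage_emb
    (measurableEmbedding_addRight h) f (Ico (a + h) (b + h))
  simpa using this

theorem setLIntegral_Ico_add_Ico (f : ℝ → ℝ≥0∞) {a b d : ℝ} (hab : a ≤ b) (hbd : b ≤ d) :
    (∫⁻ s in Ico a b, f s) + (∫⁻ s in Ico b d, f s) = ∫⁻ s in Ico a d, f s := by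
  rw [← Ico_union_Ico_eq_Ico hab hbd, lintegral_union measurableSet_Ico]
  exact Set.disjoint_left.2 fun s h1 h2 => absurd h1.2 (not_lt.2 h2.1)

/-- If time `τ` can be absorbed by a measure preserving map, the integral over a cycle of length
`τ` does not depend on the time at which the cycle starts. -/
theorem lintegral_cycle_eq {Ω : Type*} [MeasurableSpace Ω] {P : Measure Ω}
    [IsProbabilityMeasure P] {σ : Ω → Ω} (hσ : MeasurePreserving σ P P) {τ : Ω → ℝ}
    (hτ : ∀ y, 0 ≤ τ y) {f : ℝ → Ω → ℝ≥0∞} (hf : Measurable (Function.uncurry f))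
    (hf1 : ∀ s y, f s y ≤ 1) (hshift : ∀ s y, f (s + τ y) y = f s (σ y)) (h : ℝ) :
    ∫⁻ y, (∫⁻ s in Ico h (h + τ y), f s y) ∂P = ∫⁻ y, (∫⁻ s in Ico 0 (τ y), f s y) ∂P := by
  have main : ∀ (g : ℝ → Ω → ℝ≥0∞), Measurable (Function.uncurry g) → (∀ s y, g s y ≤ 1) →
      (∀ s y, g (s + τ y) y = g s (σ y)) → ∀ h, 0 ≤ h →
      ∫⁻ y, (∫⁻ s in Ico h (h + τ y), g s y) ∂P = ∫⁻ y, (∫⁻ s in Ico 0 (τ y), g s y) ∂P := by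
    intro g hg hg1 hgs h hh
    set J : Ω → ℝ≥0∞ := fun y => ∫⁻ s in Ico 0 h, g s y with hJdef
    have hJ : Measurable J := Measurable.lintegral_prod_left' (f := Function.uncurry g) hg
    have hJle : ∀ y, J y ≤ ENNReal.ofReal h := fun y => by
      refine (lintegral_mono fun s => hg1 s y).trans ?_
      simp
    -- Both sides are the integral over `[0, h + τ y)`, split at `h` and at `τ y`. The remainders `J
    -- y` and `J (σ y)` have the same expectation, which is at most `h` and can therefore be
    -- cancelled.
    have hpt : ∀ y, (∫⁻ s in Ico h (h + τ y), g s y) + J y =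
        (∫⁻ s in Ico 0 (τ y), g s y) + J (σ y) := by
      intro y
      have e1 : J (σ y) = ∫⁻ s in Ico (τ y) (h + τ y), g s y := by
        simp only [hJdef, ← hgs]
        rw [setLIntegral_Ico_add (fun s => g s y), zero_add]
      rw [e1, setLIntegral_Ico_add_Ico _ (hτ y) (by linarith), add_comm,
        setLIntegral_Ico_add_Ico _ hh (by linarith [hτ y])]
    have hsum := lintegral_congr (μ := P) hpt
    rw [lintegral_add_right _ hJ,
      lintegral_add_right (g := fun y => J (σ y)) _ (hJ.comp hσ.measurable),
      hσ.lintegral_comp hJ] at hsum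
    refine (ENNReal.add_left_inj ?_).1 hsum
    refine ((lintegral_mono hJle).trans_lt ?_).ne
    simp
  rcases le_total 0 h with hh | hh
  · exact main f hf hf1 hshift h hh
  -- For negative `h`, the case of `-h` is applied to `f` translated by `h`, which exchanges the two
  -- sides.
  · have h1 := main (fun s y => f (s + h) y)
      (hf.comp (f := fun p : ℝ × Ω => (p.1 + h, p.2)) (by fun_prop)) (fun s y => hf1 _ _)
      (fun s y => by rw [add_right_comm, hshift]) (-h) (by linarith)
    have e : ∀ y a b, ∫⁻ s in Ico a b, f (s + h) y = ∫⁻ s in Ico (a + h) (b + h), f s y :=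
      fun y a b => setLIntegral_Ico_add (fun s => f s y) a b h
    simp only [e, neg_add_cancel, zero_add, neg_add_cancel_comm] at h1
    rw [h1]
    simp only [add_comm h]

/-! ### Cycles -/

theorem MachineState.eq_of_working_iff {v v' : MachineState}
    (h : v = .working ↔ v' = .working) : v = v' := by
  cases v <;> cases v' <;> simp_all

/-- Sequences of cycles: the lifespan and the quantum of the cycle `n ∈ ℤ`. -/
abbrev Cycles : Type := MachineState × ℤ → ℝ≥0

namespace Cycles

variable (c : ℝ)

/-- The length of the cycle `n` if the broken machine receives contributions at rate `c`. -/
noncomputable def length (y : Cycles) (n : ℤ) : ℝ :=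
  y (.working, n) + y (.broken, n) / c

/-- The time at which the cycle `n` starts if the cycle `0` starts at time `0`. -/
noncomputable def start (y : Cycles) (n : ℤ) : ℝ :=
  ∑ i ∈ Finset.Ico 0 n, length c y i - ∑ i ∈ Finset.Ico n 0, length c y i

/-- The sequence of cycles seen from the cycle `1`. -/
def shift (y : Cycles) : Cycles := fun i => y (i.1, i.2 + 1)

open Classical in
/-- The state of the machine at time `s`. -/
noncomputable def state (y : Cycles) (s : ℝ) : MachineState :=
  if ∃ n, start c y n ≤ s ∧ s < start c y n + y (.working, n) then .working else .broken

variable {c} {y y' : Cycles}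

theorem length_nonneg (hc : 0 ≤ c) (y : Cycles) (n : ℤ) : 0 ≤ length c y n :=
  add_nonneg (NNReal.coe_nonneg _) (div_nonneg (NNReal.coe_nonneg _) hc)

theorem working_le_length (hc : 0 ≤ c) (y : Cycles) (n : ℤ) :
    (y (.working, n) : ℝ) ≤ length c y n :=
  le_add_of_nonneg_right (div_nonneg (NNReal.coe_nonneg _) hc)

@[simp] theorem start_zero : start c y 0 = 0 := by simp [start]

theorem start_succ (n : ℤ) : start c y (n + 1) = start c y n + length c y n := by
  rw [start, start]
  rcases le_or_gt 0 n with h | h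
  · rw [Finset.Ico_eq_empty (by omega : ¬ n + 1 < 0), Finset.Ico_eq_empty (by omega : ¬ n < 0),
      ← Finset.insert_Ico_right_eq_Ico_add_one h, Finset.sum_insert (by simp)]
    simp [add_comm]
  · rw [Finset.Ico_eq_empty (by omega : ¬ 0 < n + 1), Finset.Ico_eq_empty (by omega : ¬ 0 < n),
      ← Finset.insert_Ico_add_one_left_eq_Ico h, Finset.sum_insert (by simp)]
    simp

theorem start_one : start c y 1 = length c y 0 := by
  simpa using start_succ (c := c) (y := y) 0

theorem start_mono (hc : 0 ≤ c) (y : Cycles) : Monotone (start c y) :=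
  monotone_int_of_le_succ fun n => by
    rw [start_succ]
    exact le_add_of_nonneg_right (length_nonneg hc y n)

theorem start_shift (n : ℤ) : start c (shift y) n = start c y (n + 1) - length c y 0 := by
  induction n using Int.induction_on with
  | zero => simp [start_one]
  | succ n ih => rw [start_succ, ih, start_succ ((n : ℤ) + 1)]; simp [shift, length]; ring
  | pred n ih =>
    have h1 := start_succ (c := c) (y := shift y) (-(n : ℤ) - 1)
    have h2 := start_succ (c := c) (y := y) (-(n : ℤ) - 1 + 1)
    have h3 : length c (shift y) (-(n : ℤ) - 1) = length c y (-(n : ℤ) - 1 + 1) := rfl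
    simp only [sub_add_cancel] at h1 h2 h3 ⊢
    linarith

theorem state_eq_working {s : ℝ} :
    state c y s = .working ↔ ∃ n, start c y n ≤ s ∧ s < start c y n + y (.working, n) := by
  rw [state]
  split_ifs with h <;> simp [h]

/-- Renumbering the cycles translates the path by the length of one cycle, which is the hypothesis
of `lintegral_cycle_eq` that yields stationarity. -/
theorem state_shift (s : ℝ) : state c (shift y) s = state c y (s + length c y 0) := by
  have : (∃ n, start c (shift y) n ≤ s ∧ s < start c (shift y) n + shift y (.working, n)) ↔
      ∃ n, start c y n ≤ s + length c y 0 ∧ s + length c y 0 < start c y n + y (.working, n) := by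
    refine (Equiv.addRight (1 : ℤ)).exists_congr fun n => ?_
    rw [start_shift, Equiv.coe_addRight]
    simp only [shift]
    constructor <;> rintro ⟨h1, h2⟩ <;> constructor <;> linarith
  refine MachineState.eq_of_working_iff ?_
  rw [state_eq_working, state_eq_working, this]

theorem state_of_mem (hc : 0 ≤ c) {s : ℝ} (hs : 0 ≤ s) (hs' : s < length c y 0) :
    state c y s = .working ↔ s < y (.working, 0) := by
  rw [state_eq_working]
  constructor
  · rintro ⟨n, h1, h2⟩
    rcases lt_trichotomy n 0 with hn | rfl | hn
    · have h3 := start_mono hc y (show n + 1 ≤ 0 by omega)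
      rw [start_succ, start_zero] at h3
      linarith [working_le_length hc y n]
    · simpa using h2
    · have h3 := start_mono hc y (show 1 ≤ n by omega)
      rw [start_one] at h3
      linarith
  · intro h
    exact ⟨0, by simpa using hs, by simpa using h⟩

/-- The state up to a time in the cycle `0` is determined by the earlier cycles and the lifespan
in the cycle `0`. -/
theorem state_congr (hc : 0 ≤ c) (hW : ∀ n ≤ 0, y (.working, n) = y' (.working, n))
    (hB : ∀ n < 0, y (.broken, n) = y' (.broken, n)) {s : ℝ} (hs : s < length c y 0)
    (hs' : s < length c y' 0) : state c y s = state c y' s := by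
  have key : ∀ z : Cycles, s < length c z 0 →
      ((∃ n, start c z n ≤ s ∧ s < start c z n + z (.working, n)) ↔
        ∃ n ≤ 0, start c z n ≤ s ∧ s < start c z n + z (.working, n)) := by
    intro z hz
    constructor
    · rintro ⟨n, h1, h2⟩
      refine ⟨n, ?_, h1, h2⟩
      by_contra hn
      have h3 := start_mono hc z (show 1 ≤ n by omega)
      rw [start_one] at h3
      linarith
    · rintro ⟨n, -, h⟩
      exact ⟨n, h⟩
  have hstart : ∀ n ≤ 0, start c y n = start c y' n := by
    intro n hn
    rw [start, start, Finset.Ico_eq_empty (by omega : ¬ 0 < n)]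
    congr 1
    refine Finset.sum_congr rfl fun i hi => ?_
    have := (Finset.mem_Ico.1 hi).2
    rw [length, length, hW i this.le, hB i this]
  have : (∃ n, start c y n ≤ s ∧ s < start c y n + y (.working, n)) ↔
      ∃ n, start c y' n ≤ s ∧ s < start c y' n + y' (.working, n) := by
    rw [key y hs, key y' hs']
    refine exists_congr fun n => and_congr_right fun hn => ?_
    rw [hstart n hn, hW n hn]
  refine MachineState.eq_of_working_iff ?_
  rw [state_eq_working, state_eq_working, this]

/-- All spells have positive length, and time is exhausted in both directions. -/
structure IsProper (c : ℝ) (y : Cycles) : Prop where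
  pos : ∀ i, 0 < y i
  tendsto_atTop : Tendsto (start c y) atTop atTop
  tendsto_atBot : Tendsto (start c y) atBot atBot

theorem IsProper.isAlternating (hc : 0 < c) (h : IsProper c y) (u : ℝ) :
    IsAlternating (fun t => state c y (t + u)) (fun n => start c y n - u)
      (fun n => start c y n + y (.working, n) - u) where
  lt_end n := by
    have : (0 : ℝ) < y (.working, n) := h.pos _
    linarith
  lt_next n := by
    have : (0 : ℝ) < y (.broken, n) := h.pos _
    have : (0 : ℝ) < y (.broken, n) / c := by positivity
    rw [start_succ, length]
    linarith
  tendsto_atTop := tendsto_atTop_add_const_right _ (-u) h.tendsto_atTop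
  tendsto_atBot := tendsto_atBot_add_const_right _ (-u) h.tendsto_atBot
  working_iff t := by
    rw [state_eq_working]
    refine exists_congr fun n => ?_
    constructor <;> rintro ⟨h1, h2⟩ <;> constructor <;> linarith

theorem measurable_length (c : ℝ) (n : ℤ) : Measurable fun y : Cycles => length c y n := by
  unfold length
  fun_prop

theorem measurable_start (c : ℝ) (n : ℤ) : Measurable fun y : Cycles => start c y n := by
  unfold start
  exact (Finset.measurable_fun_sum _ fun i _ => measurable_length c i).sub
    (Finset.measurable_fun_sum _ fun i _ => measurable_length c i)

theorem measurable_state (c : ℝ) : Measurable fun p : ℝ × Cycles => state c p.2 p.1 := by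
  unfold state
  refine Measurable.ite ?_ measurable_const measurable_const
  have : {p : ℝ × Cycles | ∃ n, start c p.2 n ≤ p.1 ∧ p.1 < start c p.2 n + p.2 (.working, n)} =
      ⋃ n, {p : ℝ × Cycles | start c p.2 n ≤ p.1 ∧ p.1 < start c p.2 n + p.2 (.working, n)} := by
    ext p
    simp
  rw [this]
  refine MeasurableSet.iUnion fun n => ?_
  have hs : Measurable fun p : ℝ × Cycles => start c p.2 n :=
    (measurable_start c n).comp measurable_snd
  exact (measurableSet_le hs measurable_fst).inter
    (measurableSet_lt measurable_fst (hs.add (by fun_prop)))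

/-! ### The law of the cycles -/

section Law

variable {Θ : Type*} [MeasurableSpace Θ] (M : FluidModel Θ)

/-- The distributions of lifespans and quanta. -/
def spellLaw : MachineState → Measure ℝ≥0
  | .working => M.lifespanLaw
  | .broken => M.quantumLaw

instance (v : MachineState) : IsProbabilityMeasure (spellLaw M v) := by
  cases v
  · exact M.lifespanLaw_prob
  · exact M.quantumLaw_prob

/-- The law of independent cycles. -/
noncomputable def law : Measure Cycles :=
  Measure.infinitePi fun i : MachineState × ℤ => spellLaw M i.1

instance : IsProbabilityMeasure (law M) := by
  unfold law
  infer_instance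

theorem law_map_comp {κ : Type*} {e : κ → MachineState × ℤ} (he : Function.Injective e) :
    (law M).map (fun y k => y (e k)) = Measure.infinitePi fun k => spellLaw M (e k).1 :=
  Measure.map_infinitePi_infinitePi_of_inj he

theorem measurePreserving_eval (i : MachineState × ℤ) :
    MeasurePreserving (fun y : Cycles => y i) (law M) (spellLaw M i.1) :=
  measurePreserving_eval_infinitePi _ i

theorem measurePreserving_shift : MeasurePreserving shift (law M) (law M) :=
  ⟨by unfold shift; fun_prop, law_map_comp M (e := fun i : MachineState × ℤ => (i.1, i.2 + 1)) fun i j hij => by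
    simp only [Prod.mk.injEq, add_left_inj] at hij
    exact Prod.ext hij.1 hij.2⟩

/-- The averages converge to `1 / ρ > 0`, so the sums diverge. The enumeration `e` is free so that
it can run forwards or backwards through the cycles. -/
theorem ae_tendsto_sum_atTop {e : ℕ → ℤ} (he : Function.Injective e) :
    ∀ᵐ y ∂law M, Tendsto (fun n : ℕ => ∑ i ∈ Finset.range n, (y (.working, e i) : ℝ))
      atTop atTop := by
  have := M.lifespanLaw_prob
  have h := ae_tendsto_average_infinitePi M.lifespanLaw (one_div_nonneg.2 M.ρ_pos.le)
    M.lifespanLaw_mean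
  have hmap := law_map_comp M (e := fun k => (MachineState.working, e k)) fun i j hij =>
    he (Prod.mk.inj hij).2
  rw [show (fun k : ℕ => spellLaw M (MachineState.working, e k).1) = fun _ => M.lifespanLaw from
    rfl] at hmap
  rw [← hmap] at h
  have h' := ae_of_ae_map (Measurable.aemeasurable (by fun_prop)) h
  filter_upwards [h'] with y hy
  have := hy.pos_mul_atTop (one_div_pos.2 M.ρ_pos) tendsto_natCast_atTop_atTop
  refine this.congr' ?_
  filter_upwards [eventually_ge_atTop 1] with n hn
  have : (n : ℝ) ≠ 0 := by
    have : n ≠ 0 := by omega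
    exact_mod_cast this
  field_simp

theorem start_natCast (n : ℕ) : start c y n = ∑ i ∈ Finset.range n, length c y i := by
  induction n with
  | zero => simp
  | succ n ih => rw [Nat.cast_succ, start_succ, ih, Finset.sum_range_succ]

theorem start_neg_natCast (n : ℕ) :
    start c y (-n) = - ∑ i ∈ Finset.range n, length c y (-1 - i) := by
  induction n with
  | zero => simp
  | succ n ih =>
    have h := start_succ (c := c) (y := y) (-1 - n)
    rw [show -1 - (n : ℤ) + 1 = -n by ring, ih] at h
    rw [Nat.cast_succ, Finset.sum_range_succ, show -((n : ℤ) + 1) = -1 - n by ring]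
    linarith

theorem ae_isProper (hc : 0 < c) : ∀ᵐ y ∂law M, IsProper c y := by
  have hpos : ∀ᵐ y ∂law M, ∀ i, 0 < y i := by
    have hI : Countable (MachineState × ℤ) := by
      have : Function.Injective fun v : MachineState => (v = .working) := by
        intro v v'
        cases v <;> cases v' <;> simp
      have := this.countable
      infer_instance
    refine ae_all_iff.2 fun i => ?_
    have h : ∀ᵐ l ∂spellLaw M i.1, 0 < l := by
      rcases i with ⟨_ | _, n⟩
      · exact M.lifespanLaw_pos
      · exact M.quantumLaw_pos
    rw [← (measurePreserving_eval M i).map_eq] at h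
    exact ae_of_ae_map (measurePreserving_eval M i).aemeasurable h
  -- The working spells alone exhaust time, along the cycles `0, 1, …` and along `-1, -2, …`.
  filter_upwards [hpos, ae_tendsto_sum_atTop M Nat.cast_injective,
    ae_tendsto_sum_atTop M (e := fun i => -1 - i) fun i j hij => by
      have : (-1 - i : ℤ) = -1 - j := hij
      omega] with y h1 h2 h3
  refine ⟨h1, tendsto_atTop_atTop_of_monotone (start_mono hc.le y) fun b => ?_,
    tendsto_atBot_atBot_of_monotone (start_mono hc.le y) fun b => ?_⟩
  · obtain ⟨n, hn⟩ := (h2.eventually_ge_atTop b).exists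
    refine ⟨n, hn.trans ?_⟩
    rw [start_natCast]
    exact Finset.sum_le_sum fun i _ => working_le_length hc.le y i
  · obtain ⟨n, hn⟩ := (h3.eventually_ge_atTop (-b)).exists
    refine ⟨-n, ?_⟩
    rw [start_neg_natCast, neg_le]
    exact hn.trans (Finset.sum_le_sum fun i _ => working_le_length hc.le y _)

theorem lintegral_length (hc : 0 < c) :
    ∫⁻ y, ENNReal.ofReal (length c y 0) ∂law M = ENNReal.ofReal (1 / M.ρ + 1 / c) := by
  have h1 : ∀ y : Cycles, ENNReal.ofReal (length c y 0) =
      (y (.working, 0) : ℝ≥0∞) + ENNReal.ofReal (1 / c) * (y (.broken, 0) : ℝ≥0∞) := by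
    intro y
    rw [length, ENNReal.ofReal_add (NNReal.coe_nonneg _) (by positivity),
      ENNReal.ofReal_coe_nnreal, div_eq_mul_one_div, mul_comm,
      ENNReal.ofReal_mul (by positivity), ENNReal.ofReal_coe_nnreal]
  have h2 := (measurePreserving_eval M (.working, 0)).lintegral_comp
    (f := fun l : ℝ≥0 => (l : ℝ≥0∞)) (by fun_prop)
  have h3 := (measurePreserving_eval M (.broken, 0)).lintegral_comp
    (f := fun l : ℝ≥0 => (l : ℝ≥0∞)) (by fun_prop)
  simp only [h1]
  rw [lintegral_add_left (by fun_prop), lintegral_const_mul _ (by fun_prop), h2, h3]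
  simp only [spellLaw, M.lifespanLaw_mean, M.quantumLaw_mean, mul_one]
  rw [← ENNReal.ofReal_add (one_div_nonneg.2 M.ρ_pos.le) (by positivity)]

/-- The lifespans from the cycle `1` on and the quanta from the cycle `k` on. -/
def future (k : ℤ) (y : Cycles) : (ℕ → ℝ≥0) × (ℕ → ℝ≥0) :=
  (fun i => y (.working, i + 1), fun i => y (.broken, k + i))

theorem measurable_future (k : ℤ) : Measurable (future k) := by
  unfold future
  fun_prop

theorem law_map_future (k : ℤ) : (law M).map (future k) =
    (Measure.infinitePi fun _ : ℕ => M.lifespanLaw).prod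
      (Measure.infinitePi fun _ : ℕ => M.quantumLaw) := by
  have := M.lifespanLaw_prob
  have := M.quantumLaw_prob
  have hl := law_map_comp M (e := fun i : ℕ => (MachineState.working, (i : ℤ) + 1))
    fun i j hij => by simpa using hij
  have hm := law_map_comp M (e := fun i : ℕ => (MachineState.broken, k + (i : ℤ)))
    fun i j hij => by simpa using hij
  refine (Measure.prod_eq fun s t hs ht => ?_).symm
  rw [Measure.map_apply (measurable_future k) (hs.prod ht)]
  have hs' := hs.preimage
    (show Measurable fun (y : Cycles) (i : ℕ) => y (.working, (i : ℤ) + 1) by fun_prop)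
  have ht' := ht.preimage
    (show Measurable fun (y : Cycles) (i : ℕ) => y (.broken, k + (i : ℤ)) by fun_prop)
  have h := infinitePi_inter_eq_mul (fun i : MachineState × ℤ => spellLaw M i.1)
    (J := {i | i.1 = .working}) hs' ht'
    (fun y y' hy => by
      rw [mem_preimage, mem_preimage, funext fun i : ℕ => hy (.working, (i : ℤ) + 1) rfl])
    (fun y y' hy => by
      rw [mem_preimage, mem_preimage, funext fun i : ℕ => hy (.broken, k + (i : ℤ)) (by simp)])
  refine Eq.trans h ?_
  congr 1
  · rw [← Measure.map_apply (by fun_prop) hs]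
    exact congrArg (fun μ => μ s) hl
  · rw [← Measure.map_apply (by fun_prop) ht]
    exact congrArg (fun μ => μ t) hm

/-- Events determined by the spells before those that make up `future k` are independent of
`future k`. -/
theorem law_inter_future (k : ℤ) {D : Set Cycles} (hD : MeasurableSet D)
    (hdet : ∀ y y' : Cycles, (∀ n ≤ 0, y (.working, n) = y' (.working, n)) →
      (∀ n < k, y (.broken, n) = y' (.broken, n)) → (y ∈ D ↔ y' ∈ D))
    {F : Set ((ℕ → ℝ≥0) × (ℕ → ℝ≥0))} (hF : MeasurableSet F) :
    law M (D ∩ future k ⁻¹' F) = law M D *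
      (Measure.infinitePi fun _ : ℕ => M.lifespanLaw).prod
        (Measure.infinitePi fun _ : ℕ => M.quantumLaw) F := by
  rw [← law_map_future M k, Measure.map_apply (measurable_future k) hF]
  refine infinitePi_inter_eq_mul (fun i : MachineState × ℤ => spellLaw M i.1)
    (J := {i | (i.1 = .working ∧ i.2 ≤ 0) ∨ (i.1 = .broken ∧ i.2 < k)}) hD
    (hF.preimage (measurable_future k)) (fun y y' hy => ?_) (fun y y' hy => ?_)
  · exact hdet y y' (fun n hn => hy _ (Or.inl ⟨rfl, hn⟩)) (fun n hn => hy _ (Or.inr ⟨rfl, hn⟩))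
  · have : future k y = future k y' := by
      unfold future
      congr 1
      · exact funext fun i => hy _ (by simp)
      · exact funext fun i => hy _ (by simp)
    rw [mem_preimage, mem_preimage, this]

end Law

end Cycles

instance : Finite MachineState :=
  Finite.of_injective (fun v : MachineState => (v = .working)) fun v v' => by
    cases v <;> cases v' <;> simp

/-- Under the law of the graph of `g`, a property of `(x, g x)` holds almost surely. -/
theorem ae_map_graph {S Ω : Type*} [MeasurableSpace S] [MeasurableSpace Ω] [StandardBorelSpace Ω]
    {P : Measure S} {g : S → Ω} (hg : Measurable g) {r : S → Ω → Prop}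
    (hr : ∀ᵐ x ∂P, r x (g x)) : ∀ᵐ q ∂P.map (fun x => (x, g x)), r q.1 q.2 := by
  have hm : Measurable fun x => (x, g x) := measurable_id.prodMk hg
  have h1 : ∀ᵐ q ∂P.map (fun x => (x, g x)), q.2 = g q.1 :=
    (ae_map_iff hm.aemeasurable
      (measurableSet_eq_fun measurable_snd (hg.comp measurable_fst))).2 (by simp)
  have h2 : ∀ᵐ x ∂(P.map fun x => (x, g x)).map Prod.fst, r x (g x) := by
    rw [Measure.map_map measurable_fst hm]
    simpa [Function.comp_def] using hr
  filter_upwards [h1, ae_of_ae_map measurable_fst.aemeasurable h2] with q hq hq'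
  rwa [hq]

/-! ### Processes with levels given by a Markovian mechanism -/

namespace MarkovianMechanism

variable {Θ : Type*} [MeasurableSpace Θ] (σ : MarkovianMechanism Θ)

/-- The usage level of an agent of type `θ` in each state of the machine. -/
def usageLevel : MachineState × Θ → unitInterval
  | (.working, θ) => σ.level (θ, .working)
  | (.broken, _) => 0

/-- The contribution level of an agent of type `θ` in each state of the machine. -/
def contributionLevel : MachineState × Θ → unitInterval
  | (.working, _) => 0
  | (.broken, θ) => σ.level (θ, .broken)

theorem measurable_usageLevel : Measurable σ.usageLevel := by
  refine measurable_from_prod_countable_right fun v => ?_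
  cases v
  · exact σ.measurable_level.comp (f := fun θ => (θ, MachineState.working)) (by fun_prop)
  · exact measurable_const

theorem measurable_contributionLevel : Measurable σ.contributionLevel := by
  refine measurable_from_prod_countable_right fun v => ?_
  cases v
  · exact measurable_const
  · exact σ.measurable_level.comp (f := fun θ => (θ, MachineState.broken)) (by fun_prop)

end MarkovianMechanism

namespace SystemProcess

variable {Θ : Type*} [MeasurableSpace Θ] {S : Type*} [MeasurableSpace S]

/-- The system process with a given process of machine states and the levels prescribed by a
Markovian mechanism. -/
def ofState (σ : MarkovianMechanism Θ) (P : Measure S) [hP : IsProbabilityMeasure P]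
    (state : ℝ → S → MachineState) (hm : Measurable fun q : ℝ × S => state q.1 q.2)
    (hreg : ∀ᵐ x ∂P, IsRegularPath fun t => state t x) : SystemProcess Θ S where
  prob := P
  isProb := hP
  state := state
  usage t x θ _ := σ.usageLevel (state t x, θ)
  contribution t x θ _ := σ.contributionLevel (state t x, θ)
  measurable_state := hm
  measurable_usage := σ.measurable_usageLevel.comp
    ((hm.comp (f := fun q : ℝ × S × Θ × ℝ≥0 => (q.1, q.2.1)) (by fun_prop)).prodMk (by fun_prop))
  measurable_contribution := σ.measurable_contributionLevel.comp
    ((hm.comp (f := fun q : ℝ × S × Θ × ℝ≥0 => (q.1, q.2.1)) (by fun_prop)).prodMk (by fun_prop))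
  regular := hreg

variable {σ : MarkovianMechanism Θ} {P : Measure S} [hP : IsProbabilityMeasure P]
    {state : ℝ → S → MachineState} {hm : Measurable fun q : ℝ × S => state q.1 q.2}
    {hreg : ∀ᵐ x ∂P, IsRegularPath fun t => state t x} {M : FluidModel Θ}

theorem measurable_value_ofState (t : ℝ) : Measurable ((ofState σ P state hm hreg).value t) :=
  (Measurable.of_discrete (f := fun v : MachineState =>
    ((v, fun θ _ => σ.usageLevel (v, θ), fun θ _ => σ.contributionLevel (v, θ)) :
      SystemState Θ))).comp (measurable_state_right (X := ofState σ P state hm hreg) t)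

/-- At each time the levels are a function of the state, so the whole process is a measurable image
of the state path that commutes with time shifts. -/
theorem isStationary_ofState
    (hstat : ∀ (h : ℝ) (E : Set (ℝ → MachineState)), MeasurableSet E →
      P {x | (fun t => state (t + h) x) ∈ E} = P {x | (fun t => state t x) ∈ E}) :
    (ofState σ P state hm hreg).IsStationary := by
  intro h
  have hms : ∀ t, Measurable (state t) := measurable_state_right (X := ofState σ P state hm hreg)
  have hid : IdentDistrib (fun x t => state (t + h) x) (fun x t => state t x) P P := by
    refine ⟨(measurable_pi_lambda _ fun t => hms _).aemeasurable,
      (measurable_pi_lambda _ fun t => hms _).aemeasurable, ?_⟩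
    ext E hE
    rw [Measure.map_apply (measurable_pi_lambda _ fun t => hms _) hE,
      Measure.map_apply (measurable_pi_lambda _ fun t => hms _) hE]
    exact hstat h E hE
  refine hid.comp (u := fun (p : ℝ → MachineState) t =>
    ((p t, fun θ _ => σ.usageLevel (p t, θ), fun θ _ => σ.contributionLevel (p t, θ)) :
      SystemState Θ)) ?_
  exact measurable_pi_lambda _ fun t => (Measurable.of_discrete (f := fun v : MachineState =>
    ((v, fun θ _ => σ.usageLevel (v, θ), fun θ _ => σ.contributionLevel (v, θ)) :
      SystemState Θ))).comp (measurable_pi_apply t)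

theorem avgContribution_ofState (t : ℝ) (x : S) (θ : Θ) :
    (ofState σ P state hm hreg).avgContribution M t x θ = σ.contributionLevel (state t x, θ) := by
  have := M.isProbabilityMeasure_ageLaw θ
  simp [avgContribution, ofState]

theorem avgUsage_ofState (t : ℝ) (x : S) (θ : Θ) :
    (ofState σ P state hm hreg).avgUsage M t x θ = σ.usageLevel (state t x, θ) := by
  have := M.isProbabilityMeasure_ageLaw θ
  simp [avgUsage, ofState]

theorem contributionRate_ofState {c : ℝ}
    (hc : ∫ θ, (σ.level (θ, .broken) : ℝ) ∂M.typeLaw = c) {t : ℝ} {x : S}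
    (hx : state t x = .broken) : (ofState σ P state hm hreg).contributionRate M t x = c := by
  simp only [contributionRate, avgContribution_ofState, hx]
  exact hc

theorem quantum_ofState {c : ℝ} (hc : ∫ θ, (σ.level (θ, .broken) : ℝ) ∂M.typeLaw = c) (i : ℕ)
    (x : S) : (ofState σ P state hm hreg).quantum M i x =
      ENNReal.ofReal c * volume (brokenSpell (fun t => state t x) i) := by
  have hmx : Measurable (flipPath fun t => state t x) :=
    (Measurable.of_discrete (f := MachineState.flip)).comp
      (measurable_state_left (X := ofState σ P state hm hreg) x)
  have hs : MeasurableSet (brokenSpell (fun t => state t x) i) := by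
    rw [← workingSpell_flipPath]
    exact measurableSet_workingSpell hmx i
  refine (setLIntegral_congr_fun (g := fun _ => ENNReal.ofReal c) hs fun t ht => ?_).trans ?_
  · rw [contributionRate_ofState hc ht.2.1]
  · rw [setLIntegral_const]

theorem reducedFormAt_ofState (t : ℝ) {q : ℝ} (hq : P.real {x | state t x = .working} = q) :
    (ofState σ P state hm hreg).reducedFormAt M t =
      ⟨fun θ => σ.level (θ, .working) * q, fun θ => σ.level (θ, .broken) * (1 - q), q⟩ := by
  have hmw : MeasurableSet {x | state t x = .working} :=
    measurableSet_state_right (X := ofState σ P state hm hreg) t .working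
  have hcompl : P.real {x | state t x = .working}ᶜ = 1 - q := by
    rw [probReal_compl_eq_one_sub hmw, hq]
  have hU : ∀ (θ : Θ) (x : S), (σ.usageLevel (state t x, θ) : ℝ) =
      {x | state t x = .working}.indicator (fun _ => (σ.level (θ, .working) : ℝ)) x := by
    intro θ x
    cases h : state t x
    · rw [indicator_of_mem (by exact h)]
      rfl
    · rw [indicator_of_notMem (by simp [h])]
      rfl
  have hC : ∀ (θ : Θ) (x : S), (σ.contributionLevel (state t x, θ) : ℝ) =
      {x | state t x = .working}ᶜ.indicator (fun _ => (σ.level (θ, .broken) : ℝ)) x := by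
    intro θ x
    cases h : state t x
    · rw [indicator_of_notMem (by simp [h])]
      rfl
    · rw [indicator_of_mem (by simp [h])]
      rfl
  ext θ
  · simp only [reducedFormAt, avgUsage_ofState, hU]
    refine (integral_indicator_const _ hmw).trans ?_
    rw [smul_eq_mul, mul_comm, ← hq]
    rfl
  · simp only [reducedFormAt, avgContribution_ofState, hC]
    refine (integral_indicator_const _ hmw.compl).trans ?_
    rw [smul_eq_mul, mul_comm, ← hcompl]
    rfl
  · exact hq

/-- A process with the levels of a Markovian mechanism whose fresh lifespans and quanta are
independent draws is admissible and induced by the mechanism. -/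
theorem isAdmissible_and_isCompatible_ofState
    (hstat : ∀ (h : ℝ) (E : Set (ℝ → MachineState)), MeasurableSet E →
      P {x | (fun t => state (t + h) x) ∈ E} = P {x | (fun t => state t x) ∈ E})
    (hl : ∀ᵐ x ∂P, lifespan (fun t => state t x) 0 < ∞)
    (hq : ∀ᵐ x ∂P, (ofState σ P state hm hreg).quantum M 0 x < ∞)
    {draws : S → (ℕ → ℝ≥0) × (ℕ → ℝ≥0)} (hd : Measurable draws)
    (hlaw : P.map draws = (Measure.infinitePi (fun _ : ℕ => M.lifespanLaw)).prod
        (Measure.infinitePi (fun _ : ℕ => M.quantumLaw)))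
    {hist : S → (Iic (0 : ℝ) → SystemState Θ) × ℝ≥0∞ × ℝ≥0∞} (hhm : Measurable hist)
    (hhist : (ofState σ P state hm hreg).history M =ᵐ[P] hist) (hindep : IndepFun hist draws P)
    (hagree : ∀ᵐ x ∂P, (ofState σ P state hm hreg).LifespansAgree x (draws x).1 ∧
        (ofState σ P state hm hreg).QuantaAgree M x (draws x).2) :
    (ofState σ P state hm hreg).IsAdmissible M ∧ σ.IsCompatible M (ofState σ P state hm hreg) := by
  have := M.lifespanLaw_prob
  have := M.quantumLaw_prob
  have hfst : ∀ {Ω : Type} [MeasurableSpace Ω] {g : S → Ω} (_ : Measurable g),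
      (P.map fun x => (x, g x)).map Prod.fst = P := fun {_ _ g} hg => by
    have hm : Measurable fun x => (x, g x) := measurable_id.prodMk hg
    rw [Measure.map_map measurable_fst hm]
    exact Measure.map_id
  have hsnd : ∀ {Ω : Type} [MeasurableSpace Ω] {g : S → Ω} (_ : Measurable g),
      (P.map fun x => (x, g x)).map Prod.snd = P.map g := fun {_ _ g} hg => by
    have hm : Measurable fun x => (x, g x) := measurable_id.prodMk hg
    rw [Measure.map_map measurable_snd hm]
    rfl
  -- The draws are functions of the sample point, so the laws of their graphs serve as couplings.
  refine ⟨⟨isStationary_ofState hstat, hl, ⟨P.map fun x => (x, (draws x).1), hfst hd.fst, ?_,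
    ae_map_graph hd.fst (hagree.mono fun _ h => h.1)⟩, hq,
    ⟨P.map fun x => (x, (draws x).2), hfst hd.snd, ?_,
    ae_map_graph hd.snd (hagree.mono fun _ h => h.2)⟩, ?_, ?_⟩, ?_, ?_,
    P.map fun x => (x, draws x), hfst hd, (hsnd hd).trans hlaw, ?_,
    ae_map_graph (r := fun x d => (ofState σ P state hm hreg).LifespansAgree x d.1 ∧
      (ofState σ P state hm hreg).QuantaAgree M x d.2) hd hagree⟩
  · rw [hsnd hd.fst, ← Measure.fst_prod (μ := Measure.infinitePi fun _ : ℕ => M.lifespanLaw)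
      (ν := Measure.infinitePi fun _ : ℕ => M.quantumLaw), ← hlaw, Measure.fst,
      Measure.map_map measurable_fst hd]
    rfl
  · rw [hsnd hd.snd, ← Measure.snd_prod (μ := Measure.infinitePi fun _ : ℕ => M.lifespanLaw)
      (ν := Measure.infinitePi fun _ : ℕ => M.quantumLaw), ← hlaw, Measure.snd,
      Measure.map_map measurable_snd hd]
    rfl
  · refine Eventually.of_forall fun x t θ z => ?_
    change (σ.usageLevel (state t x, θ) : ℝ) ≤ {s | state s x = .working}.indicator 1 t
    cases h : state t x
    · rw [indicator_of_mem (by exact h)]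
      exact (σ.usageLevel (_, θ)).2.2
    · rw [indicator_of_notMem (by simp [h])]
      exact le_rfl
  · refine Eventually.of_forall fun x t θ z => ?_
    change (σ.contributionLevel (state t x, θ) : ℝ) ≤ {s | state s x = .broken}.indicator 1 t
    cases h : state t x
    · rw [indicator_of_notMem (by simp [h])]
      exact le_rfl
    · rw [indicator_of_mem (by exact h)]
      exact (σ.contributionLevel (_, θ)).2.2
  · refine Eventually.of_forall fun x t ht θ z => ?_
    change state t x = .working at ht
    simp [ofState, ht, MarkovianMechanism.usageLevel, MarkovianMechanism.contributionLevel]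
  · refine Eventually.of_forall fun x t ht θ z => ?_
    change state t x = .broken at ht
    simp [ofState, ht, MarkovianMechanism.usageLevel, MarkovianMechanism.contributionLevel]
  · have hg : Measurable fun x => (x, draws x) := measurable_id.prodMk hd
    have h1 : IndepFun (fun q : S × (ℕ → ℝ≥0) × (ℕ → ℝ≥0) => hist q.1) Prod.snd
        (P.map fun x => (x, draws x)) := by
      rw [indepFun_iff_measure_inter_preimage_eq_mul] at hindep ⊢
      intro s t hs ht
      have hs' : MeasurableSet ((fun q : S × (ℕ → ℝ≥0) × (ℕ → ℝ≥0) => hist q.1) ⁻¹' s) :=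
        hs.preimage (hhm.comp measurable_fst)
      have ht' : MeasurableSet ((Prod.snd : S × (ℕ → ℝ≥0) × (ℕ → ℝ≥0) → _) ⁻¹' t) :=
        ht.preimage measurable_snd
      rw [Measure.map_apply hg (hs'.inter ht'), Measure.map_apply hg hs',
        Measure.map_apply hg ht']
      exact hindep s t hs ht
    -- Independence is proved for the measurable version `hist` and passes to the history by almost
    -- sure equality.
    refine h1.congr ?_ EventuallyEq.rfl
    have h2 : ∀ᵐ x ∂(P.map fun x => (x, draws x)).map Prod.fst,
        (ofState σ P state hm hreg).history M x = hist x := by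
      rw [hfst hd]
      exact hhist
    filter_upwards [ae_of_ae_map measurable_fst.aemeasurable h2] with q hq
    exact hq.symm

end SystemProcess

namespace Cycles

variable {Θ : Type*} [MeasurableSpace Θ] (M : FluidModel Θ) (c : ℝ)

/-! ### The stationary alternating renewal process -/

/-- The pairs of a time and a sequence of cycles such that the time is in the cycle `0`. -/
def inCycle : Set (ℝ × Cycles) := {q | 0 ≤ q.1 ∧ q.1 < length c q.2 0}

theorem measurableSet_inCycle : MeasurableSet (inCycle c) :=
  (measurableSet_le measurable_const measurable_fst).inter
    (measurableSet_lt measurable_fst ((measurable_length c 0).comp measurable_snd))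

/-- The law of a uniformly distributed time in the cycle `0`, where sequences of cycles are
weighted by the length of this cycle. -/
noncomputable def stationaryLaw : Measure (ℝ × Cycles) :=
  (ENNReal.ofReal (1 / M.ρ + 1 / c))⁻¹ • ((volume.prod (law M)).restrict (inCycle c))

variable {c}

theorem lintegral_inCycle {f : ℝ × Cycles → ℝ≥0∞} (hf : Measurable f) :
    ∫⁻ q in inCycle c, f q ∂(volume.prod (law M)) =
      ∫⁻ y, (∫⁻ u in Ico 0 (length c y 0), f (u, y)) ∂law M := by
  rw [← lintegral_indicator (measurableSet_inCycle c),
    lintegral_prod_symm' _ (hf.indicator (measurableSet_inCycle c))]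
  refine lintegral_congr fun y => ?_
  rw [← lintegral_indicator measurableSet_Ico]
  rfl

theorem cycle_mean_pos (hc : 0 < c) : 0 < 1 / M.ρ + 1 / c :=
  add_pos (one_div_pos.2 M.ρ_pos) (one_div_pos.2 hc)

theorem isProbabilityMeasure_stationaryLaw (hc : 0 < c) :
    IsProbabilityMeasure (stationaryLaw M c) := by
  constructor
  have h := lintegral_inCycle M (c := c) (f := fun _ => 1) measurable_const
  simp only [setLIntegral_one, Real.volume_Ico, sub_zero, lintegral_length M hc] at h
  rw [stationaryLaw, Measure.smul_apply, Measure.restrict_apply_univ, h, smul_eq_mul]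
  exact ENNReal.inv_mul_cancel (ENNReal.ofReal_pos.2 (cycle_mean_pos M hc)).ne'
    ENNReal.ofReal_ne_top

theorem ae_stationaryLaw (hc : 0 < c) :
    ∀ᵐ q ∂stationaryLaw M c, IsProper c q.2 ∧ 0 ≤ q.1 ∧ q.1 < length c q.2 0 := by
  refine Measure.ae_smul_measure ?_ _
  have h1 : ∀ᵐ q ∂(volume.prod (law M)).restrict (inCycle c), IsProper c q.2 :=
    ae_restrict_of_ae (Measure.quasiMeasurePreserving_snd.ae (ae_isProper M hc))
  filter_upwards [h1, ae_restrict_mem (measurableSet_inCycle c)] with q hq hq'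
  exact ⟨hq, hq'⟩

theorem measurable_path_stationary :
    Measurable fun q : ℝ × (ℝ × Cycles) => state c q.2.2 (q.1 + q.2.1) :=
  (measurable_state c).comp (f := fun q : ℝ × (ℝ × Cycles) => (q.1 + q.2.1, q.2.2)) (by fun_prop)

theorem indicator_one_congr {α β : Type*} {s : Set α} {t : Set β} {a : α} {b : β}
    (h : a ∈ s ↔ b ∈ t) : s.indicator (1 : α → ℝ≥0∞) a = t.indicator (1 : β → ℝ≥0∞) b := by
  by_cases ha : a ∈ s
  · rw [indicator_of_mem ha, indicator_of_mem (h.1 ha)]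
    rfl
  · rw [indicator_of_notMem ha, indicator_of_notMem (mt h.2 ha)]

theorem stationaryLaw_shift (hc : 0 < c) (h : ℝ) {E : Set (ℝ → MachineState)}
    (hE : MeasurableSet E) :
    stationaryLaw M c {q | (fun t => state c q.2 (t + h + q.1)) ∈ E} =
      stationaryLaw M c {q | (fun t => state c q.2 (t + q.1)) ∈ E} := by
  have hm : Measurable fun p : ℝ × Cycles => fun t : ℝ => state c p.2 (t + p.1) :=
    measurable_pi_lambda _ fun t => (measurable_state c).comp
      (f := fun p : ℝ × Cycles => (t + p.1, p.2)) (by fun_prop)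
  have hG : MeasurableSet {p : ℝ × Cycles | (fun t : ℝ => state c p.2 (t + p.1)) ∈ E} :=
    hE.preimage hm
  set f : ℝ → Cycles → ℝ≥0∞ := fun s y =>
    {p : ℝ × Cycles | (fun t : ℝ => state c p.2 (t + p.1)) ∈ E}.indicator 1 (s, y)
  have hf : Measurable (Function.uncurry f) := measurable_one.indicator hG
  have hcyc := lintegral_cycle_eq (measurePreserving_shift M) (τ := fun y => length c y 0)
    (fun y => length_nonneg hc.le y 0) hf
    (fun s y => indicator_le_self' (fun _ _ => zero_le_one) _) (fun s y => by
      have : (fun t => state c (shift y) (t + s)) =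
          fun t => state c y (t + (s + length c y 0)) := by
        funext t
        rw [state_shift, add_assoc]
      refine indicator_one_congr ?_
      change (fun t => state c y (t + (s + length c y 0))) ∈ E ↔
        (fun t => state c (shift y) (t + s)) ∈ E
      rw [this]) h
  -- Before normalisation, the measure of an event for the path moved by `a` is the expected time
  -- that the event holds in a window of one cycle length starting at `a`; `hcyc` says that `a` does
  -- not matter.
  have hmeas : ∀ a : ℝ, (volume.prod (law M)).restrict (inCycle c)
      {q | (fun t => state c q.2 (t + a + q.1)) ∈ E} =
        ∫⁻ y, (∫⁻ s in Ico a (a + length c y 0), f s y) ∂law M := by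
    intro a
    have hma : MeasurableSet {q : ℝ × Cycles | (fun t => state c q.2 (t + a + q.1)) ∈ E} := by
      have := hG.preimage
        (show Measurable fun p : ℝ × Cycles => (a + p.1, p.2) by fun_prop)
      simpa only [preimage_ofPred_eq, ← add_assoc] using this
    rw [← lintegral_indicator_one hma, lintegral_inCycle M (measurable_one.indicator hma)]
    refine lintegral_congr fun y => ?_
    have h1 := setLIntegral_Ico_add (fun s => f s y) 0 (length c y 0) a
    rw [zero_add, add_comm (length c y 0)] at h1
    rw [← h1]
    refine lintegral_congr fun u => ?_
    refine indicator_one_congr ?_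
    change (fun t => state c y (t + a + u)) ∈ E ↔ (fun t => state c y (t + (u + a))) ∈ E
    simp only [add_assoc, add_comm a u]
  have h0 := hmeas 0
  simp only [add_zero, zero_add] at h0
  rw [stationaryLaw, Measure.smul_apply, Measure.smul_apply, hmeas h, hcyc, h0]

/-- Within the cycle `0` the working times make up its lifespan, so the uptime is the ratio of the
mean lifespan `1 / ρ` to the mean cycle length `1 / ρ + 1 / c`. -/
theorem stationaryLaw_working (hc : 0 < c) :
    (stationaryLaw M c).real {q | state c q.2 q.1 = .working} = c / (M.ρ + c) := by
  have hρ := M.ρ_pos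
  have hms : MeasurableSet {q : ℝ × Cycles | state c q.2 q.1 = .working} :=
    (measurable_state c) (MeasurableSet.of_discrete (s := {MachineState.working}))
  have h1 : (volume.prod (law M)).restrict (inCycle c) {q | state c q.2 q.1 = .working} =
      ENNReal.ofReal (1 / M.ρ) := by
    rw [← lintegral_indicator_one hms, lintegral_inCycle M (measurable_one.indicator hms)]
    have h2 : ∀ y : Cycles, ∫⁻ u in Ico 0 (length c y 0),
        {q : ℝ × Cycles | state c q.2 q.1 = .working}.indicator 1 (u, y) =
          (y (.working, 0) : ℝ≥0∞) := by
      intro y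
      rw [setLIntegral_congr_fun (g := (Ico 0 (y (.working, 0) : ℝ)).indicator 1)
        measurableSet_Ico fun u hu => ?_]
      · rw [lintegral_indicator_one measurableSet_Ico, Measure.restrict_apply measurableSet_Ico,
          inter_eq_left.2 (Ico_subset_Ico_right (working_le_length hc.le y 0))]
        simp
      · have := state_of_mem hc.le hu.1 hu.2
        exact indicator_one_congr (this.trans ⟨fun h => ⟨hu.1, h⟩, fun h => h.2⟩)
    simp only [h2]
    rw [(measurePreserving_eval M (.working, 0)).lintegral_comp
      (f := fun l : ℝ≥0 => (l : ℝ≥0∞)) (by fun_prop)]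
    exact M.lifespanLaw_mean
  rw [measureReal_def, stationaryLaw, Measure.smul_apply, h1, smul_eq_mul, ENNReal.toReal_mul,
    ENNReal.toReal_inv, ENNReal.toReal_ofReal (cycle_mean_pos M hc).le,
    ENNReal.toReal_ofReal (by positivity)]
  field_simp
  ring

/-! ### Spells after time `0` -/

open Classical in
/-- The lifespans and quanta that start after time `0` if the cycle `0` is in progress and has
started at time `-u`. -/
noncomputable def draws (q : ℝ × Cycles) : (ℕ → ℝ≥0) × (ℕ → ℝ≥0) :=
  -- If the cycle `0` is still working, its own quantum is the first fresh one; otherwise that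
  -- quantum is already in use. The first fresh lifespan is that of the cycle `1` in either case.
  if q.1 < q.2 (.working, 0) then future 0 q.2 else future 1 q.2

theorem measurableSet_lt_working :
    MeasurableSet {q : ℝ × Cycles | q.1 < q.2 (.working, 0)} :=
  measurableSet_lt measurable_fst (by fun_prop)

theorem measurable_draws : Measurable draws :=
  Measurable.ite measurableSet_lt_working ((measurable_future 0).comp measurable_snd)
    ((measurable_future 1).comp measurable_snd)

open Classical in
/-- The residual duration of the broken spell in progress at time `0`. -/
noncomputable def residualBroken (c : ℝ) (q : ℝ × Cycles) : ℝ :=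
  if q.1 < q.2 (.working, 0) then 0 else length c q.2 0 - q.1

theorem measurable_residualBroken : Measurable (residualBroken c) :=
  Measurable.ite measurableSet_lt_working measurable_const
    (((measurable_length c 0).comp measurable_snd).sub measurable_fst)

theorem volume_Ioi_inter_Ico {a b : ℝ} (ha : a ≤ 0) :
    volume (Ioi 0 ∩ Ico a b) = ENNReal.ofReal b := by
  have : Ioi 0 ∩ Ico a b = Ioo 0 b := by
    ext t
    constructor
    · rintro ⟨h1, h2⟩
      exact ⟨h1, h2.2⟩
    · rintro ⟨h1, h2⟩
      exact ⟨h1, ha.trans (le_of_lt h1), h2⟩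
  rw [this, Real.volume_Ioo, sub_zero]

section Spells

variable {q : ℝ × Cycles} (hc : 0 < c) (hq : IsProper c q.2) (h0 : 0 ≤ q.1)
  (h1 : q.1 < length c q.2 0)
include hc hq h0 h1

theorem lifespan_zero :
    lifespan (fun t => state c q.2 (t + q.1)) 0 =
      ENNReal.ofReal (q.2 (.working, 0) - q.1) := by
  have h := hq.isAlternating hc q.1
  rw [lifespan, h.workingSpell_eq (k := 0) (by simpa using h0) (by simpa [start_one] using h1),
    volume_Ioi_inter_Ico (by simpa using h0)]
  simp

theorem lifespan_succ (i : ℕ) :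
    lifespan (fun t => state c q.2 (t + q.1)) (i + 1) = q.2 (.working, i + 1) := by
  have h := hq.isAlternating hc q.1
  rw [lifespan, h.workingSpell_succ (k := 0) (by simpa using h0) (by simpa [start_one] using h1),
    Real.volume_Ico]
  simp

theorem volume_brokenSpell_zero :
    volume (brokenSpell (fun t => state c q.2 (t + q.1)) 0) =
      ENNReal.ofReal (residualBroken c q) := by
  have h := (hq.isAlternating hc q.1).flip
  rw [← workingSpell_flipPath, residualBroken]
  split_ifs with hw
  -- While the cycle `0` works, the last breakdown is that of the cycle `-1`. Its broken spell ended
  -- at `-q.1 ≤ 0`, so nothing of it remains after time `0`.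
  · have hk : start c q.2 (-1) + q.2 (.working, -1) - q.1 ≤ 0 := by
      have := start_succ (c := c) (y := q.2) (-1)
      have := working_le_length hc.le q.2 (-1)
      simp at *
      linarith
    rw [h.workingSpell_eq (k := -1) hk (by simpa using hw), volume_Ioi_inter_Ico (by simpa using hk)]
    simp [h0]
  · have hk : start c q.2 0 + q.2 (.working, 0) - q.1 ≤ 0 := by
      simpa using hw
    have hk' : 0 < start c q.2 (0 + 1) + q.2 (.working, 0 + 1) - q.1 := by
      have : (0 : ℝ) ≤ q.2 (.working, 0 + 1) := NNReal.coe_nonneg _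
      rw [zero_add, start_one]
      rw [zero_add] at this
      linarith
    rw [h.workingSpell_eq (k := 0) hk hk', volume_Ioi_inter_Ico (by simpa using hk)]
    simp [start_one]

theorem volume_brokenSpell_succ (i : ℕ) :
    volume (brokenSpell (fun t => state c q.2 (t + q.1)) (i + 1)) =
      ENNReal.ofReal ((draws q).2 i / c) := by
  have h := (hq.isAlternating hc q.1).flip
  have hlen : ∀ n : ℤ, start c q.2 (n + 1) - q.1 - (start c q.2 n + q.2 (.working, n) - q.1) =
      q.2 (.broken, n) / c := fun n => by
    rw [start_succ, length]
    ring
  rw [← workingSpell_flipPath, draws]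
  split_ifs with hw
  · have hk : start c q.2 (-1) + q.2 (.working, -1) - q.1 ≤ 0 := by
      have := start_succ (c := c) (y := q.2) (-1)
      have := working_le_length hc.le q.2 (-1)
      simp at *
      linarith
    rw [h.workingSpell_succ (k := -1) hk (by simpa using hw), Real.volume_Ico, hlen]
    simp [future]
  · have hk : start c q.2 0 + q.2 (.working, 0) - q.1 ≤ 0 := by
      simpa using hw
    have hk' : 0 < start c q.2 (0 + 1) + q.2 (.working, 0 + 1) - q.1 := by
      have : (0 : ℝ) ≤ q.2 (.working, 0 + 1) := NNReal.coe_nonneg _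
      rw [zero_add, start_one]
      rw [zero_add] at this
      linarith
    rw [h.workingSpell_succ (k := 0) hk hk', Real.volume_Ico, hlen]
    simp [future, add_comm]

end Spells

/-! ### Independence of the past and the fresh draws -/

/-- If, within the cycle `0`, a measurable event is determined by the past of the cycles, then it
is independent of the fresh lifespans and quanta. -/
theorem stationaryLaw_inter_draws (hc : 0 < c) {D : Set (ℝ × Cycles)} (hD : MeasurableSet D)
    (hdet : ∀ u y y', u < length c y 0 → u < length c y' 0 →
      (∀ n ≤ 0, y (.working, n) = y' (.working, n)) →
      (∀ n < 0, y (.broken, n) = y' (.broken, n)) →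
      (u < y (.working, 0) ∨ y (.broken, 0) = y' (.broken, 0)) →
      ((u, y) ∈ D ↔ (u, y') ∈ D))
    {F : Set ((ℕ → ℝ≥0) × (ℕ → ℝ≥0))} (hF : MeasurableSet F) :
    stationaryLaw M c (D ∩ draws ⁻¹' F) = stationaryLaw M c D *
      (Measure.infinitePi fun _ : ℕ => M.lifespanLaw).prod
        (Measure.infinitePi fun _ : ℕ => M.quantumLaw) F := by
  have hDF : MeasurableSet (D ∩ draws ⁻¹' F) := hD.inter (hF.preimage measurable_draws)
  have hC := measurableSet_inCycle c
  have hsec : ∀ (G : Set (ℝ × Cycles)) (u : ℝ), MeasurableSet G →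
      MeasurableSet (Prod.mk u ⁻¹' G) := fun G u hG => hG.preimage (by fun_prop)
  set ν := (Measure.infinitePi fun _ : ℕ => M.lifespanLaw).prod
        (Measure.infinitePi fun _ : ℕ => M.quantumLaw)
  -- For a fixed elapsed time `u` the length weighting becomes the condition that the cycle `0`
  -- lasts beyond `u`, and independence can be checked under the unweighted law.
  have key : ∀ u : ℝ, law M (Prod.mk u ⁻¹' (D ∩ draws ⁻¹' F ∩ inCycle c)) =
      law M (Prod.mk u ⁻¹' (D ∩ inCycle c)) * ν F := by
    intro u
    set A : Set Cycles := {y | u < y (.working, 0)} with hA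
    have hAm : MeasurableSet A := hsec _ u measurableSet_lt_working
    rw [← measure_inter_add_sdiff (Prod.mk u ⁻¹' (D ∩ draws ⁻¹' F ∩ inCycle c)) hAm,
      ← measure_inter_add_sdiff (Prod.mk u ⁻¹' (D ∩ inCycle c)) hAm, add_mul]
    congr 1
    -- If the cycle `0` works at `u`, it lasts beyond `u` whatever its quantum, so the event does
    -- not depend on that quantum, which counts as fresh.
    · rw [← law_inter_future M 0 ((hsec _ u (hD.inter hC)).inter hAm) _ hF]
      · congr 1
        ext y
        by_cases hy : u < y (.working, 0) <;> simp [hA, hy, draws]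
        tauto
      · intro y y' hW hB
        have hAy : u < y (.working, 0) ↔ u < y' (.working, 0) := by rw [hW 0 le_rfl]
        constructor <;> rintro ⟨⟨h1, h2, h3⟩, h4⟩
        · have h4' := hAy.1 h4
          have h5 : u < length c y' 0 := h4'.trans_le (working_le_length hc.le y' 0)
          exact ⟨⟨(hdet u y y' h3 h5 hW hB (Or.inl h4)).1 h1, h2, h5⟩, h4'⟩
        · have h4' := hAy.2 h4
          have h5 : u < length c y 0 := h4'.trans_le (working_le_length hc.le y 0)
          exact ⟨⟨(hdet u y y' h5 h3 hW hB (Or.inl h4')).2 h1, h2, h5⟩, h4'⟩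
    -- If the machine is broken at `u`, the quantum of the cycle `0` belongs to the past and
    -- determines whether the cycle is still in progress.
    · rw [← law_inter_future M 1 ((hsec _ u (hD.inter hC)).diff hAm) _ hF]
      · congr 1
        ext y
        by_cases hy : u < y (.working, 0) <;> simp [hA, hy, draws]
        tauto
      · intro y y' hW hB
        have hB0 := hB 0 one_pos
        have hB' : ∀ n < 0, y (.broken, n) = y' (.broken, n) := fun n hn => hB n (by omega)
        have hAy : u < y (.working, 0) ↔ u < y' (.working, 0) := by rw [hW 0 le_rfl]
        have hlen : length c y 0 = length c y' 0 := by
          rw [length, length, hW 0 le_rfl, hB0]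
        constructor <;> rintro ⟨⟨h1, h2, h3⟩, h4⟩
        · have h5 : u < length c y' 0 := hlen ▸ h3
          exact ⟨⟨(hdet u y y' h3 h5 hW hB' (Or.inr hB0)).1 h1, h2, h5⟩, fun h => h4 (hAy.2 h)⟩
        · have h5 : u < length c y 0 := hlen ▸ h3
          exact ⟨⟨(hdet u y y' h5 h3 hW hB' (Or.inr hB0)).2 h1, h2, h5⟩, fun h => h4 (hAy.1 h)⟩
  rw [stationaryLaw, Measure.smul_apply, Measure.smul_apply, Measure.restrict_apply hDF,
    Measure.restrict_apply hD, Measure.prod_apply (hDF.inter hC),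
    Measure.prod_apply (hD.inter hC), lintegral_congr key,
    lintegral_mul_const _ (measurable_measure_prodMk_left (hD.inter hC)), smul_eq_mul, smul_eq_mul,
    mul_assoc]

theorem stationaryLaw_map_draws (hc : 0 < c) : (stationaryLaw M c).map draws =
    (Measure.infinitePi fun _ : ℕ => M.lifespanLaw).prod
      (Measure.infinitePi fun _ : ℕ => M.quantumLaw) := by
  have := isProbabilityMeasure_stationaryLaw M hc
  ext F hF
  have h := stationaryLaw_inter_draws M hc MeasurableSet.univ (by simp) hF
  rwa [univ_inter, measure_univ, one_mul, ← Measure.map_apply measurable_draws hF] at h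

end Cycles

variable {Θ : Type*} [MeasurableSpace Θ]

/-! ### Sufficiency of the physical constraints -/

open Cycles SystemProcess in
/-- A Markovian mechanism with a positive contribution rate induces a stationary process. -/
theorem exists_process_of_contribution_pos (M : FluidModel Θ) (σ : MarkovianMechanism Θ) {c : ℝ}
    (hc : 0 < c) (hσ : ∫ θ, (σ.level (θ, .broken) : ℝ) ∂M.typeLaw = c) :
    ∃ X : SystemProcess Θ (ℝ × Cycles), X.IsAdmissible M ∧ σ.IsCompatible M X ∧
      X.HasReducedForm M ⟨fun θ => σ.level (θ, .working) * (c / (M.ρ + c)),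
        fun θ => σ.level (θ, .broken) * (1 - c / (M.ρ + c)), c / (M.ρ + c)⟩ := by
  have hP := isProbabilityMeasure_stationaryLaw M hc
  have hreg : ∀ᵐ q ∂stationaryLaw M c, IsRegularPath fun t => state c q.2 (t + q.1) := by
    filter_upwards [ae_stationaryLaw M hc] with q hq
    exact (hq.1.isAlternating hc q.1).isRegularPath
  have hm : Measurable fun q : ℝ × (ℝ × Cycles) => state c q.2.2 (q.1 + q.2.1) :=
    measurable_path_stationary
  set X := ofState σ (stationaryLaw M c) (fun t q => state c q.2 (t + q.1)) hm hreg with hX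
  have hquantum : ∀ i q, X.quantum M i q = ENNReal.ofReal c *
      volume (brokenSpell (fun t => state c q.2 (t + q.1)) i) := fun i q => quantum_ofState hσ i q
  have hvm : ∀ t, Measurable (X.value t) := fun t => measurable_value_ofState t
  -- The explicit formulas for the residuals give a version of the history that is measurable and
  -- visibly determined by the past cycles.
  set hist : ℝ × Cycles → (Iic (0 : ℝ) → SystemState Θ) × ℝ≥0∞ × ℝ≥0∞ := fun q =>
    (fun t => X.value t q, ENNReal.ofReal (q.2 (.working, 0) - q.1),
      ENNReal.ofReal c * ENNReal.ofReal (residualBroken c q)) with hhist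
  have hhm : Measurable hist := by
    have h1 : Measurable fun (q : ℝ × Cycles) (t : Iic (0 : ℝ)) => X.value t q :=
      measurable_pi_lambda _ fun t => hvm t
    have h2 : Measurable fun q : ℝ × Cycles => ENNReal.ofReal (q.2 (.working, 0) - q.1) := by
      fun_prop
    have h3 : Measurable fun q : ℝ × Cycles =>
        ENNReal.ofReal c * ENNReal.ofReal (residualBroken c q) :=
      measurable_residualBroken.ennreal_ofReal.const_mul _
    exact h1.prodMk (h2.prodMk h3)
  have hcong : ∀ u y y', u < length c y 0 → u < length c y' 0 →
      (∀ n ≤ 0, y (.working, n) = y' (.working, n)) →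
      (∀ n < 0, y (.broken, n) = y' (.broken, n)) →
      (u < y (.working, 0) ∨ y (.broken, 0) = y' (.broken, 0)) → hist (u, y) = hist (u, y') := by
    intro u y y' hu hu' hW hB h0
    have hs : ∀ t : Iic (0 : ℝ), state c y (t + u) = state c y' (t + u) := fun t => by
      have ht : (t : ℝ) ≤ 0 := t.2
      exact state_congr hc.le hW hB (by linarith) (by linarith)
    have hr : residualBroken c (u, y) = residualBroken c (u, y') := by
      simp only [residualBroken, ← hW 0 le_rfl]
      split_ifs with h
      · rfl
      · rw [length, length, hW 0 le_rfl, h0.resolve_left h]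
    refine Prod.ext (funext fun t => ?_) (Prod.ext ?_ ?_)
    · simp only [hhist, hX, value, ofState, hs t]
    · simp only [hhist, hW 0 le_rfl]
    · simp only [hhist, hr]
  have hindep : IndepFun hist draws (stationaryLaw M c) := by
    rw [indepFun_iff_measure_inter_preimage_eq_mul]
    intro s F hs hF
    rw [stationaryLaw_inter_draws M hc (hs.preimage hhm) _ hF, ← stationaryLaw_map_draws M hc,
      Measure.map_apply measurable_draws hF]
    intro u y y' hu hu' hW hB h0
    rw [mem_preimage, mem_preimage, hcong u y y' hu hu' hW hB h0]
  have hadm := isAdmissible_and_isCompatible_ofState (M := M) (σ := σ)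
    (P := stationaryLaw M c) (state := fun t q => state c q.2 (t + q.1)) (hm := hm) (hreg := hreg)
    (draws := draws) (hist := hist)
    (fun h E hE => stationaryLaw_shift M hc h hE)
    (by
      filter_upwards [ae_stationaryLaw M hc] with q hq
      rw [lifespan_zero hc hq.1 hq.2.1 hq.2.2]
      exact ENNReal.ofReal_lt_top)
    (by
      filter_upwards [ae_stationaryLaw M hc] with q hq
      rw [← hX, hquantum, volume_brokenSpell_zero hc hq.1 hq.2.1 hq.2.2]
      exact ENNReal.mul_lt_top ENNReal.ofReal_lt_top ENNReal.ofReal_lt_top)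
    measurable_draws (stationaryLaw_map_draws M hc) hhm
    (by
      filter_upwards [ae_stationaryLaw M hc] with q hq
      refine Prod.ext rfl (Prod.ext ?_ ?_)
      · exact lifespan_zero hc hq.1 hq.2.1 hq.2.2
      · exact (hquantum 0 q).trans (by rw [volume_brokenSpell_zero hc hq.1 hq.2.1 hq.2.2]))
    hindep
    (by
      filter_upwards [ae_stationaryLaw M hc] with q hq
      have hL : ∀ i : ℕ, lifespan (X.path q) (i + 1) = (draws q).1 i := fun i => by
        refine (lifespan_succ hc hq.1 hq.2.1 hq.2.2 i).trans ?_
        rw [draws]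
        split_ifs <;> rfl
      have hQ : ∀ i : ℕ, X.quantum M (i + 1) q = (draws q).2 i := fun i => by
        rw [hquantum, volume_brokenSpell_succ hc hq.1 hq.2.1 hq.2.2, ← ENNReal.ofReal_mul hc.le,
          mul_div_cancel₀ _ hc.ne', ENNReal.ofReal_coe_nnreal]
      exact ⟨fun i => ⟨(hL i).le, fun _ => hL i⟩, fun i => ⟨(hQ i).le, fun _ => hQ i⟩⟩)
  refine ⟨X, hadm.1, hadm.2, fun t => reducedFormAt_ofState t ?_⟩
  -- The uptime was computed at time `0`; shift invariance carries it to time `t`.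
  have hE : MeasurableSet {p : ℝ → MachineState | p 0 = .working} :=
    measurable_pi_apply (X := fun _ : ℝ => MachineState) 0
      (MeasurableSet.of_discrete (s := {MachineState.working}))
  have hsh := stationaryLaw_shift M hc t hE
  simp only [mem_ofPred_eq, zero_add] at hsh
  rw [← stationaryLaw_working M hc, measureReal_def, measureReal_def, hsh]

theorem fixCount_const (v : MachineState) (t : ℝ) : fixCount (fun _ => v) t = 0 := by
  have : ∀ s, ¬ IsFixTime (fun _ => v) s := by
    rintro s ⟨h1, h2⟩
    obtain ⟨u, hu⟩ := h2.exists
    rw [h1] at hu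
    cases hu
  simp [fixCount, this]

open SystemProcess in
/-- If nobody contributes to the broken machine, it may remain broken forever. -/
theorem exists_process_of_contribution_zero (M : FluidModel Θ) (σ : MarkovianMechanism Θ)
    (hσ : ∫ θ, (σ.level (θ, .broken) : ℝ) ∂M.typeLaw = 0) :
    ∃ X : SystemProcess Θ ((ℕ → ℝ≥0) × (ℕ → ℝ≥0)), X.IsAdmissible M ∧ σ.IsCompatible M X ∧
      X.HasReducedForm M ⟨fun θ => σ.level (θ, .working) * 0,
        fun θ => σ.level (θ, .broken) * (1 - 0), 0⟩ := by
  have := M.lifespanLaw_prob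
  have := M.quantumLaw_prob
  set P := (Measure.infinitePi (fun _ : ℕ => M.lifespanLaw)).prod
        (Measure.infinitePi (fun _ : ℕ => M.quantumLaw))
  have hreg : ∀ᵐ _ ∂P, IsRegularPath fun _ => MachineState.broken :=
    Eventually.of_forall fun _ _ => ⟨by simp, .broken, by simp⟩
  set X := ofState σ P (fun _ _ => MachineState.broken) measurable_const hreg with hX
  have hL : ∀ x i, lifespan (X.path x) i = 0 := fun x i => by
    have : workingSpell (X.path x) i = ∅ := eq_empty_of_forall_notMem fun t ht => by
      have h : MachineState.broken = .working := ht.2.1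
      cases h
    rw [lifespan, this, measure_empty]
  have hQ : ∀ x i, X.quantum M i x = 0 := fun x i => by
    rw [hX, quantum_ofState hσ, ENNReal.ofReal_zero, zero_mul]
  -- The sample space carries only the draws, which the constant path ignores. The history is
  -- constant and thus independent of them, and no spell is ever completed.
  have hadm := isAdmissible_and_isCompatible_ofState (M := M) (σ := σ) (P := P)
    (state := fun _ _ => MachineState.broken) (hm := measurable_const) (hreg := hreg)
    (draws := id) (hist := fun _ => (fun _ => (.broken, fun θ _ => σ.usageLevel (.broken, θ),
      fun θ _ => σ.contributionLevel (.broken, θ)), 0, 0))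
    (fun _ _ _ => rfl)
    (Eventually.of_forall fun x => (hL x 0).trans_lt ENNReal.zero_lt_top)
    (Eventually.of_forall fun x => (hQ x 0).trans_lt ENNReal.zero_lt_top)
    measurable_id Measure.map_id measurable_const
    (Eventually.of_forall fun x => Prod.ext rfl (Prod.ext (hL x 0) (hQ x 0)))
    (indepFun_const_left _ _)
    (Eventually.of_forall fun x => by
      constructor
      -- The machine is broken at every time, so completion is excluded by the count: it is `0`,
      -- never `i + 1`.
      · refine fun i => ⟨(hL x _).trans_le zero_le, ?_⟩
        rintro ⟨t, -, -, h⟩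
        have h' : fixCount (fun _ => MachineState.broken) t = (i + 1 : ℕ) := h
        rw [fixCount_const] at h'
        exact absurd h'.symm (by simp)
      · refine fun i => ⟨(hQ x _).trans_le zero_le, ?_⟩
        rintro ⟨t, -, h, -⟩
        have h' : MachineState.broken = .working := h
        cases h')
  refine ⟨X, hadm.1, hadm.2, fun t => reducedFormAt_ofState t ?_⟩
  simp

/-- The mechanism that induces a given triple: the levels conditional on the state. -/
noncomputable def Triple.mechanism (T : Triple Θ) {M : FluidModel Θ} (hT : T.IsPhysical M) :
    MarkovianMechanism Θ where
  level
    -- For `Q = 0` the quotient is `0` by convention, which is harmless since then `R = 0` too.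
    | (θ, .working) => ⟨T.R θ / T.Q, div_nonneg (hT.R_mem θ).1 hT.Q_mem.1,
      div_le_one_of_le₀ (hT.simplex_R θ) hT.Q_mem.1⟩
    | (θ, .broken) => ⟨T.P θ / (1 - T.Q), div_nonneg (hT.P_mem θ).1 (sub_nonneg.2 hT.Q_mem.2),
      div_le_one_of_le₀ (hT.simplex_P θ) (sub_nonneg.2 hT.Q_mem.2)⟩
  measurable_level := by
    refine measurable_from_prod_countable_left fun v => ?_
    cases v
    · exact (hT.measurable_R.div_const _).subtype_mk
    · exact (hT.measurable_P.div_const _).subtype_mk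

theorem Triple.IsPhysical.exists_process {T : Triple Θ} {M : FluidModel Θ} (hT : T.IsPhysical M) :
    ∃ (σ : MarkovianMechanism Θ) (S : Type) (_ : MeasurableSpace S) (X : SystemProcess Θ S),
      X.IsAdmissible M ∧ σ.IsCompatible M X ∧ X.HasReducedForm M T := by
  have hρ := M.ρ_pos
  -- A machine that always works leaves no room for contributions: `Q = 1` gives `P = 0`, and
  -- balance would give `ρ = 0`.
  have hQ1 : T.Q < 1 := by
    refine lt_of_le_of_ne hT.Q_mem.2 fun h => ?_
    have hP : ∀ θ, T.P θ = 0 := fun θ =>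
      le_antisymm ((hT.simplex_P θ).trans_eq (by rw [h, sub_self])) (hT.P_mem θ).1
    have := hT.balance
    simp only [hP, integral_zero, h, mul_one] at this
    exact hρ.ne' this
  have hB : ∫ θ, ((T.mechanism hT).level (θ, .broken) : ℝ) ∂M.typeLaw =
      M.ρ * T.Q / (1 - T.Q) := by
    rw [hT.balance, ← integral_div]
    rfl
  have h1Q : 1 - T.Q ≠ 0 := (sub_pos.2 hQ1).ne'
  rcases hT.Q_mem.1.eq_or_lt with h0 | h0
  · obtain ⟨X, h1, h2, h3⟩ := exists_process_of_contribution_zero M (T.mechanism hT)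
      (by rw [hB, ← h0, mul_zero, zero_div])
    refine ⟨T.mechanism hT, _, _, X, h1, h2, fun t => (h3 t).trans ?_⟩
    ext θ
    · have h := hT.simplex_R θ
      rw [← h0] at h
      simp [le_antisymm h (hT.R_mem θ).1]
    · simp [Triple.mechanism, ← h0]
    · exact h0
  -- With `c = ρ Q / (1 - Q)`, the uptime `c / (ρ + c)` of the induced process is `Q`.
  · have hq : M.ρ * T.Q / (1 - T.Q) / (M.ρ + M.ρ * T.Q / (1 - T.Q)) = T.Q := by
      have : M.ρ + M.ρ * T.Q / (1 - T.Q) = M.ρ / (1 - T.Q) := by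
        field_simp
        ring
      rw [this]
      field_simp
    obtain ⟨X, h1, h2, h3⟩ := exists_process_of_contribution_pos M (T.mechanism hT)
      (div_pos (mul_pos hρ h0) (sub_pos.2 hQ1)) hB
    refine ⟨T.mechanism hT, _, _, X, h1, h2, fun t => (h3 t).trans ?_⟩
    rw [hq]
    ext θ
    · exact div_mul_cancel₀ _ h0.ne'
    · exact div_mul_cancel₀ _ h1Q
    · rfl

end FluidClub

theorem proposition6 {Θ : Type*} [MeasurableSpace Θ] (M : FluidClub.FluidModel Θ) :
    (∀ (S : Type*) [MeasurableSpace S] (X : FluidClub.SystemProcess Θ S),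
      X.IsAdmissible M →
        ∃ T : FluidClub.Triple Θ, X.HasReducedForm M T ∧ T.IsPhysical M) ∧
    (∀ T : FluidClub.Triple Θ, T.IsPhysical M →
      ∃ (σ : FluidClub.MarkovianMechanism Θ) (S : Type) (_ : MeasurableSpace S)
        (X : FluidClub.SystemProcess Θ S),
        X.IsAdmissible M ∧ σ.IsCompatible M X ∧ X.HasReducedForm M T) :=
  ⟨fun _ _ X hX => ⟨X.reducedFormAt M 0, hX.stationary.hasReducedForm, hX.isPhysical⟩,
    fun _ hT => hT.exists_process⟩
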